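/- **Setting.** Let $\mathcal X$ be a measurable space and $\mathcal Y=\{-1,1\}$. Let $\mathcal H\subseteq\mathcal Y^{\mathcal X}$ be a class of measurable hypotheses. A finite set $F\subseteq\mathcal X$ is *shattered* by $\mathcal H$ if every map $F\to\mathcal Y$ is the restriction of some $h\in\mathcal H$; the *VC dimension* of $\mathcal H$ is the supremum of $|F|$ over shattered $F$. For a hypothesis $h$ and a finite sequence $S\in(\mathcal X\times\mathcal Y)^*$ put $\Sigma_{\neq}(h,S)=\sum_{(x,y)\in S}\mathbf 1\{h(x)\ne y\}$. An *ERM learner* for $\mathcal H$ is a map $\mathcal A:(\mathcal X\times\mathcal Y)^*\to\mathcal H$ such that $\mathcal A(S)$ minimises the empirical error $\Sigma_{\neq}(h,S)/|S|$ over $h\in\mathcal H$, for every $S$. It is *measurable* if $(S,x)\mapsto\mathcal A(S)(x)$ is measurable on $(\mathcal X\times\mathcal Y)^n\times\mathcal X$ for every $n$. For a probability distribution $\mathcal D$ on $\mathcal X\times\mathcal Y$, a *best hypothesis* is an $h^\star\in\mathcal H$ that minimises $\Pr_{(x,y)\sim\mathcal D}[h(x)\neq y]$ over $h\in\mathcal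 H$. **Splitting scheme.** For sequences $S,T\in(\mathcal X\times\mathcal Y)^*$ with $|S|=3^k$ define a finite family $\mathcal S(S;T)$ of sequences recursively. Write $\sqcup$ for concatenation. If $k<6$, then $\mathcal S(S;T)$ consists of the single sequence $S\sqcup T$. If $k\ge 6$, cut $S$ into $27$ consecutive blocks $S_1,\dots,S_{27}$ of length $3^{k-3}$, let $S_{i,\sqcup}$ be the first $3^{k-6}$ entries of $S_i$ and $S_{i,\sqcap}$ the remaining $3^{k-3}-3^{k-6}$ entries, and let $\mathcal S(S;T)$ be the concatenation of the families $\mathcal S(S_{i,\sqcup};\,S_{i,\sqcap}\sqcup T)$, $i=1,\dots,27$. Put $s_\sqcap=\frac{27}{1-1/27}$, which is $|S|/|S_{i,\sqcap}|$ when $k\ge6$. Let $\mathcal A(S;T)=(\mathcal A(S'))_{S'\in\mathcal S(S;T)}$, a multiset of hypotheses, and let $$L_{\mathcal D}^{\alpha}(\mathcal A(S;T))=\Pr_{(x,y)\sim\mathcal D}\bigl[\text{at least an }\alpha\text{ fraction of the }h\in\mathcal A(S;T)\text{ satisfy }h(x)\ne y\bigr].$$ **Theorem.** There is a universal constant $c\ge1$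 such that the following holds. Let $\mathcal H$ be a class of measurable hypotheses of finite VC dimension $d$ on a measurable space $\mathcal X$, let $\mathcal A$ be a measurable ERM learner for $\mathcal H$, let $\mathcal D$ be a probability distribution on $\mathcal X\times\{-1,1\}$, and let $h^\star\in\mathcal H$ be a best hypothesis. Then for every $\delta\in(0,1)$, every $m=3^k$ with $k\in\mathbb N$ (including $k=0$), and every fixed $T\in(\mathcal X\times\{-1,1\})^*$, with probability at least $1-\delta$ over $S\sim\mathcal D^m$, $$L_{\mathcal D}^{10/243}(\mathcal A(S;T))\;\le\;\max_{S'\in\mathcal S(S;T)}\frac{c\,\Sigma_{\neq}(h^\star,S')}{m/s_\sqcap}+\frac{c\,(d+\ln(1/\delta))}{m}.$$ -/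

import Mathlib

/-!
Symmetrisation and the Sauer–Shelah lemma give a relative deviation inequality: outside an event of
probability `exp (-L)`, every classifier `g` of the class errs in a fixed region `R` with
probability at most a constant times `(Σ(g, S) + d log (1 / θ) + L) / |S| + θ D(R)`.

If an example is misclassified by a `10/243` fraction of the whole ensemble, then the error
fractions of the 27 blocks add up to at least `10/9`. Some block `i` has a fraction of at least
`10/243`, and the other blocks still contribute at least `1/9`. So it is enough to bound the
probability of `R i ∩ {g errs}`, where `R i` is the region in which a `10/243` fraction of block `i`
errs and `g` is a hypothesis of a block `j ≠ i`. Conditionally on all other sample points, `R i` is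
fixed and the tail of block `j` is a fresh i.i.d. sample. This tail is part of the training sequence
`S'` of `g`, so that `Σ(g, tail) ≤ Σ(g, S') ≤ Σ(h⋆, S')`. By induction `D(R i)` is already of the
right order up to a constant, which a small `θ` absorbs.
-/

open MeasureTheory

noncomputable section

namespace AgnosticVC

/-- The label set `{-1, +1}`. -/
abbrev Label : Type := ℤˣ

/-- Every set of labels is measurable. -/
instance : DiscreteMeasurableSpace Label :=
  ⟨fun s => ⟨Units.val '' s, MeasurableSet.of_discrete,
    Set.preimage_image_eq s Units.val_injective⟩⟩

/-- A labelled example over the domain `X`. -/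
abbrev Example (X : Type*) : Type _ := X × Label

/-- A hypothesis (classifier) on `X`. -/
abbrev Hypothesis (X : Type*) : Type _ := X → Label

/-- A learner maps finite training sequences to hypotheses. -/
abbrev Learner (X : Type*) : Type _ := List (Example X) → Hypothesis X

variable {X : Type*}

/-- `H` shatters the finite set `s`: every labelling of `s` is realised by some `h ∈ H`. -/
def Shatters (H : Set (Hypothesis X)) (s : Finset X) : Prop :=
  ∀ f : X → Label, ∃ h ∈ H, ∀ x ∈ s, h x = f x

/-- The VC dimension of `H`: the supremum of the sizes of the finite sets shattered by `H`. -/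
def vcDim (H : Set (Hypothesis X)) : ℕ∞ :=
  ⨆ s : {s : Finset X // Shatters H s}, (s.1.card : ℕ∞)

/-- The number of entries of the training sequence `S`, with multiplicity, on which `h` errs. -/
def errCount (h : Hypothesis X) (S : List (Example X)) : ℕ :=
  S.countP fun z => h z.1 ≠ z.2

/-- The empirical error of `h` on the training sequence `S`. -/
def empError (h : Hypothesis X) (S : List (Example X)) : ℝ :=
  (errCount h S : ℝ) / S.length

/-- The true error of `h` with respect to the distribution `D`. -/
def trueError [MeasurableSpace X] (D : Measure (Example X)) (h : Hypothesis X) : ℝ :=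
  D.real {z | h z.1 ≠ z.2}

/-- `h` is a best hypothesis of `H` for the distribution `D`. -/
def IsBest [MeasurableSpace X] (D : Measure (Example X)) (H : Set (Hypothesis X))
    (h : Hypothesis X) : Prop :=
  h ∈ H ∧ ∀ g ∈ H, trueError D h ≤ trueError D g

/-- `A` is an empirical risk minimisation learner for `H`. -/
def IsERM (H : Set (Hypothesis X)) (A : Learner X) : Prop :=
  ∀ S : List (Example X), A S ∈ H ∧ ∀ g ∈ H, empError (A S) S ≤ empError g S

/-- `A` is a measurable learner: for each sample size `n`, the prediction at `x` of the hypothesis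
trained on `S` is a jointly measurable function of `(S, x)`. -/
def IsMeasurableLearner [MeasurableSpace X] (A : Learner X) : Prop :=
  ∀ n : ℕ, Measurable fun p : (Fin n → Example X) × X => A (List.ofFn p.1) p.2

/-- The recursive splitting scheme, for an active sequence `S` of length `3 ^ k`. If `6 ≤ k`, then
`S` is cut into 27 consecutive blocks of length `3 ^ (k - 3)`; the recursion is run, for every
block, on its first `3 ^ (k - 6)` entries, and its other entries are put in front of `T`. -/
def split {Z : Type*} (k : ℕ) (S T : List Z) : List (List Z) :=
  if 6 ≤ k then
    (List.range 27).flatMap fun i =>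
      let block := (S.drop (i * 3 ^ (k - 3))).take (3 ^ (k - 3))
      split (k - 6) (block.take (3 ^ (k - 6))) (block.drop (3 ^ (k - 6)) ++ T)
  else [S ++ T]
termination_by k

theorem split_ne_nil {Z : Type*} (k : ℕ) (S T : List Z) : split k S T ≠ [] := by
  induction k using Nat.strong_induction_on generalizing S T with
  | _ k ih =>
    unfold split
    split_ifs with h
    · intro h0
      rw [List.flatMap_eq_nil_iff] at h0
      exact ih (k - 6) (by omega) _ _ (h0 0 (by simp))
    · simp

/-- The multiset (as a list) of the hypotheses that `A` outputs on the members of the family that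
the splitting scheme returns. -/
def ensemble (A : Learner X) (k : ℕ) (S T : List (Example X)) : List (Hypothesis X) :=
  (split k S T).map A

/-- The fraction of the hypotheses in the list `L` that err on the example `z`. -/
def avgErr (L : List (Hypothesis X)) (z : Example X) : ℝ :=
  (L.countP fun h => h z.1 ≠ z.2 : ℝ) / L.length

/-- The probability over an example from `D` that at least an `α` fraction of the hypotheses in `L`
err on it. -/
def ensembleError [MeasurableSpace X] (D : Measure (Example X)) (α : ℝ)
    (L : List (Hypothesis X)) : ℝ :=
  D.real {z | α ≤ avgErr L z}

/-- The ratio `|S| / |S_⊓| = 3 ^ k / (3 ^ (k - 3) - 3 ^ (k - 6))` of the splitting scheme. -/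
def sCap : ℝ := 27 / (1 - 1 / 27)

theorem ratio_eq_sCap (k : ℕ) (h : 6 ≤ k) :
    (3 ^ k : ℝ) / (3 ^ (k - 3) - 3 ^ (k - 6)) = sCap := by
  obtain ⟨j, rfl⟩ := Nat.exists_eq_add_of_le' h
  have h3 : j + 6 - 3 = j + 3 := by omega
  rw [h3, Nat.add_sub_cancel, sCap, pow_add, pow_add]
  have hj : (3 : ℝ) ^ j ≠ 0 := by positivity
  rw [show (3 : ℝ) ^ j * 3 ^ 3 - 3 ^ j = 3 ^ j * 26 by ring]
  field_simp
  norm_num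

end AgnosticVC

end

noncomputable section

namespace AgnosticVC

open scoped ENNReal

section Resampling

variable {κ τ Z : Type*} [MeasurableSpace Z]

theorem measurable_extend_prod (e : κ → τ) :
    Measurable fun p : (κ → Z) × (τ → Z) => Function.extend e p.1 p.2 := by
  refine measurable_pi_lambda _ fun t => ?_
  by_cases ht : ∃ a, e a = t
  · simp only [Function.extend, dif_pos ht]
    fun_prop
  · simp only [Function.extend, dif_neg ht]
    fun_prop

variable [Fintype κ] [Fintype τ] (μ : Measure Z) [IsProbabilityMeasure μ]

theorem measurePreserving_extend {e : κ → τ} (he : Function.Injective e) :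
    MeasurePreserving (fun p : (κ → Z) × (τ → Z) => Function.extend e p.1 p.2)
      ((Measure.pi fun _ => μ).prod (Measure.pi fun _ => μ)) (Measure.pi fun _ => μ) := by
  classical
  refine ⟨measurable_extend_prod e, (Measure.pi_eq fun s hs => ?_).symm⟩
  set I : Finset τ := Finset.univ.map ⟨e, he⟩
  have hbox : (fun p : (κ → Z) × (τ → Z) => Function.extend e p.1 p.2) ⁻¹' Set.univ.pi s =
      (Set.univ.pi fun a => s (e a)) ×ˢ (Set.univ.pi fun t => if t ∈ I then Set.univ else s t) := by
    ext ⟨x, y⟩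
    simp only [Set.mem_preimage, Set.mem_univ_pi, Set.mem_prod]
    refine ⟨fun h => ⟨fun a => by simpa only [he.extend_apply] using h (e a), fun t => ?_⟩,
      fun h t => ?_⟩
    · split_ifs with ht
      · trivial
      · simpa only [Function.extend_apply' x y t (by simpa [I] using ht)] using h t
    · by_cases ht : t ∈ I
      · obtain ⟨a, rfl⟩ : ∃ a, e a = t := by simpa [I] using ht
        simpa only [he.extend_apply] using h.1 a
      · simpa only [Function.extend_apply' x y t (by simpa [I] using ht), if_neg ht] using h.2 t
  rw [Measure.map_apply (measurable_extend_prod e) (.univ_pi hs), hbox, Measure.prod_prod,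
    Measure.pi_pi, Measure.pi_pi, ← Finset.prod_mul_prod_compl I fun t => μ (s t), Finset.prod_map]
  simp only [apply_ite μ, measure_univ, Finset.prod_ite, Finset.prod_const_one, one_mul,
    Function.Embedding.coeFn_mk, ← Finset.filter_notMem_eq_sdiff,
    Finset.compl_eq_univ_sdiff]

/-- It suffices to bound the conditional probability of `B` given the coordinates outside the range
of `e`. -/
theorem measure_pi_le_of_forall_extend {e : κ → τ} (he : Function.Injective e) {B : Set (τ → Z)}
    (hB : MeasurableSet B) {ε : ℝ≥0∞}
    (h : ∀ z, Measure.pi (fun _ => μ) {s | Function.extend e s z ∈ B} ≤ ε) :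
    Measure.pi (fun _ => μ) B ≤ ε := by
  rw [← (measurePreserving_extend μ he).measure_preimage hB.nullMeasurableSet,
    Measure.prod_apply_symm (measurable_extend_prod e hB)]
  calc _ ≤ ∫⁻ _ : τ → Z, ε ∂(Measure.pi fun _ => μ) := lintegral_mono h
    _ = ε := by rw [lintegral_const, measure_univ, mul_one]

theorem lintegral_pi_prod {f : Z → ℝ≥0∞} (hf : Measurable f) :
    ∫⁻ z, ∏ i, f (z i) ∂(Measure.pi fun _ : κ => μ) = (∫⁻ x, f x ∂μ) ^ Fintype.card κ := by
  rw [ProbabilityTheory.lintegral_prod_eq_prod_lintegral_of_indepFun Finset.univ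
    (fun i (z : κ → Z) => f (z i)) (ProbabilityTheory.iIndepFun_pi fun _ => hf.aemeasurable)
    fun i => hf.comp (measurable_pi_apply i)]
  simp only [(measurePreserving_eval (fun _ : κ => μ) _).lintegral_comp hf,
    Finset.prod_const, Finset.card_univ]

end Resampling

section Traces

variable {κ Z : Type*}

/-- The family `C` of sets has Vapnik–Chervonenkis dimension at most `d`. -/
def VCBound (C : Set (Set Z)) (d : ℕ) : Prop :=
  ∀ w : Finset Z, (∀ t ⊆ w, ∃ c ∈ C, ∀ x ∈ w, x ∈ c ↔ x ∈ t) → w.card ≤ d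

variable [Fintype κ]

open scoped Classical in
/-- The traces of the family `C` of sets on the points `z i`, recorded as sets of indices. -/
def traces (C : Set (Set Z)) (z : κ → Z) : Finset (Finset κ) :=
  {B | ∃ c ∈ C, (B : Set κ) = z ⁻¹' c}

theorem mem_traces {C : Set (Set Z)} {z : κ → Z} {B : Finset κ} :
    B ∈ traces C z ↔ ∃ c ∈ C, (B : Set κ) = z ⁻¹' c := by
  simp only [traces, Finset.mem_filter, Finset.mem_univ, true_and]

theorem VCBound.card_le_of_shatters_traces [DecidableEq κ] {C : Set (Set Z)} {d : ℕ}
    (hC : VCBound C d) {z : κ → Z} {s : Finset κ} (hs : (traces C z).Shatters s) :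
    s.card ≤ d := by
  classical
  have exists_trace : ∀ t ⊆ s, ∃ c ∈ C, ∀ i ∈ s, z i ∈ c ↔ i ∈ t := by
    intro t ht
    obtain ⟨u, hu, rfl⟩ := hs ht
    obtain ⟨c, hc, huc⟩ := mem_traces.1 hu
    refine ⟨c, hc, fun i hi => ?_⟩
    rw [← Set.mem_preimage, ← huc, Finset.mem_coe, Finset.mem_inter, and_iff_right hi]
  have hinj : Set.InjOn z s := by
    intro i hi j hj hij
    obtain ⟨c, -, hc⟩ := exists_trace {i} (Finset.singleton_subset_iff.2 hi)
    have hjc := (hc i hi).2 (Finset.mem_singleton_self i)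
    rw [hij, hc j hj] at hjc
    exact (Finset.mem_singleton.1 hjc).symm
  rw [← Finset.card_image_of_injOn hinj]
  refine hC _ fun t _ => ?_
  obtain ⟨c, hc, hct⟩ := exists_trace {i ∈ s | z i ∈ t} (Finset.filter_subset _ _)
  refine ⟨c, hc, fun x hx => ?_⟩
  obtain ⟨i, hi, rfl⟩ := Finset.mem_image.1 hx
  rw [hct i hi, Finset.mem_filter, and_iff_right hi]

theorem shatterer_traces_subset [DecidableEq κ] {C : Set (Set Z)} {R : Set Z}
    (hR : ∀ c ∈ C, c ⊆ R) {z : κ → Z} {s : Finset κ} (hs : (traces C z).Shatters s) :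
    ∀ i ∈ s, z i ∈ R := by
  intro i hi
  obtain ⟨u, hu, hsu⟩ := hs.exists_superset
  obtain ⟨c, hc, huc⟩ := mem_traces.1 hu
  refine hR c hc (?_ : i ∈ z ⁻¹' c)
  exact huc ▸ hsu hi

/-- The Sauer–Shelah lemma, weighting a shattered set of `j ≤ d` indices by `θ ^ (j - d) ≥ 1`. -/
theorem VCBound.pow_mul_card_traces_le {C : Set (Set Z)} {d : ℕ} (hC : VCBound C d) {R : Set Z}
    (hR : ∀ c ∈ C, c ⊆ R) {θ : ℝ≥0∞} (hθ : θ ≤ 1) (z : κ → Z) :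
    θ ^ d * (traces C z).card ≤ ∏ i, R.mulIndicator (fun _ => 1 + θ) (z i) := by
  classical
  set I : Finset κ := {i | z i ∈ R}
  have hsub : (traces C z).shatterer ⊆ I.powerset.filter fun s => s.card ≤ d := by
    intro s hs
    rw [Finset.mem_shatterer] at hs
    refine Finset.mem_filter.2 ⟨Finset.mem_powerset.2 fun i hi => ?_,
      hC.card_le_of_shatters_traces hs⟩
    simpa [I] using shatterer_traces_subset hR hs i hi
  calc θ ^ d * (traces C z).card
      ≤ θ ^ d * (I.powerset.filter fun s => s.card ≤ d).card := by
        gcongr θ ^ d * ?_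
        exact_mod_cast (Finset.card_le_card_shatterer _).trans (Finset.card_le_card hsub)
    _ = ∑ _s ∈ I.powerset.filter (fun s => s.card ≤ d), θ ^ d := by
        rw [Finset.sum_const, nsmul_eq_mul, mul_comm]
    _ ≤ ∑ s ∈ I.powerset.filter (fun s => s.card ≤ d), θ ^ s.card :=
        Finset.sum_le_sum fun _ hs => pow_le_pow_right_of_le_one' hθ (Finset.mem_filter.1 hs).2
    _ ≤ ∑ s ∈ I.powerset, θ ^ s.card :=
        Finset.sum_le_sum_of_subset (Finset.filter_subset _ _)
    _ = (1 + θ) ^ I.card := by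
        simp only [← Finset.prod_const, Finset.prod_one_add]
    _ = ∏ i, R.mulIndicator (fun _ => 1 + θ) (z i) := by
        simp only [Set.mulIndicator_apply, Finset.prod_ite, Finset.prod_const_one, mul_one,
          Finset.prod_const, I]

end Traces

section Symmetrization

variable {κ ι Z : Type*}

/-- Exchanges the two copies of `i` for every `i` with `σ i = true`. -/
def swapCopies (σ : κ → Bool) : Equiv.Perm (κ ⊕ κ) :=
  Function.Involutive.toPerm
    (Sum.elim (fun i => bif σ i then .inr i else .inl i) fun i => bif σ i then .inl i else .inr i)
    (by rintro (i | i) <;> cases h : σ i <;> simp [h])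

theorem swapCopies_inl (σ : κ → Bool) (i : κ) :
    swapCopies σ (.inl i) = bif σ i then .inr i else .inl i := rfl

theorem swapCopies_inr (σ : κ → Bool) (i : κ) :
    swapCopies σ (.inr i) = bif σ i then .inl i else .inr i := rfl

theorem sum_prod_swapCopies_le [Fintype κ] [DecidableEq κ] {u v : κ ⊕ κ → ℝ≥0∞}
    (h : ∀ i, u (.inl i) * v (.inr i) + u (.inr i) * v (.inl i) ≤ 2) :
    ∑ σ : κ → Bool, ∏ i, u (swapCopies σ (.inl i)) * v (swapCopies σ (.inr i)) ≤
      2 ^ Fintype.card κ := by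
  calc ∑ σ : κ → Bool, ∏ i, u (swapCopies σ (.inl i)) * v (swapCopies σ (.inr i))
      = ∑ σ : κ → Bool, ∏ i, bif σ i then u (.inr i) * v (.inl i) else u (.inl i) * v (.inr i) := by
        refine Finset.sum_congr rfl fun σ _ => Finset.prod_congr rfl fun i _ => ?_
        simp only [swapCopies_inl, swapCopies_inr]
        cases σ i <;> simp only [cond_true, cond_false]
    _ = ∏ i, ∑ b : Bool, bif b then u (.inr i) * v (.inl i) else u (.inl i) * v (.inr i) :=
        (Fintype.prod_sum fun i b =>
          bif b then u (.inr i) * v (.inl i) else u (.inl i) * v (.inr i)).symm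
    _ ≤ ∏ _i : κ, 2 := Finset.prod_le_prod' fun i _ => by
        simpa only [Fintype.sum_bool, cond_true, cond_false, add_comm] using h i
    _ = 2 ^ Fintype.card κ := by rw [Finset.prod_const, Finset.card_univ]

theorem mulIndicator_mul_add_le_two {α : Type*} {a c : ℝ≥0∞} (hac : a + c ≤ 1) (F : Set α)
    (x y : α) : F.mulIndicator (fun _ => a) x * F.mulIndicator (fun _ => 1 + c) y +
      F.mulIndicator (fun _ => a) y * F.mulIndicator (fun _ => 1 + c) x ≤ 2 := by
  have ha : a * (1 + c) ≤ 1 := by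
    rw [mul_add, mul_one]
    refine le_trans ?_ hac
    gcongr
    exact mul_le_of_le_one_left' (le_self_add.trans hac)
  have hac' : a + (1 + c) ≤ 2 := by
    rw [add_left_comm, ← one_add_one_eq_two]
    gcongr
  by_cases hx : x ∈ F <;> by_cases hy : y ∈ F <;>
    simp only [hx, hy, Set.mulIndicator_of_mem, Set.mulIndicator_of_notMem, not_false_eq_true,
      one_mul, mul_one]
  · exact (add_le_add ha ha).trans one_add_one_eq_two.le
  · exact hac'
  · rwa [add_comm]
  · exact one_add_one_eq_two.le

variable [Fintype κ]

/-- The symmetrised weight of the sample `z ∘ inl` together with the ghost sample `z ∘ inr`, with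
respect to the sets `E l` which depend on the sample: a sample point in `E l` contributes the
factor `a`, a ghost point in `E l` the factor `1 + c`. -/
def symWeight (a c : ℝ≥0∞) (E : ι → (κ → Z) → Set Z) (z : κ ⊕ κ → Z) : ℝ≥0∞ :=
  ⨆ l, ∏ i, (E l (z ∘ .inl)).mulIndicator (fun _ => a) (z (.inl i)) *
    (E l (z ∘ .inl)).mulIndicator (fun _ => 1 + c) (z (.inr i))

/-- The sets `E l` are recomputed after each swap, but they still cut out one of the traces of `C`
on all `2 |κ|` points, and these do not depend on the swap. -/
theorem symWeight_comp_swapCopies_le {C : Set (Set Z)} {E : ι → (κ → Z) → Set Z}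
    (hE : ∀ l S, E l S ∈ C) (a c : ℝ≥0∞) (z : κ ⊕ κ → Z) (σ : κ → Bool) :
    symWeight a c E (z ∘ swapCopies σ) ≤ ∑ B ∈ traces C z,
      ∏ i, (B : Set (κ ⊕ κ)).mulIndicator (fun _ => a) (swapCopies σ (.inl i)) *
        (B : Set (κ ⊕ κ)).mulIndicator (fun _ => 1 + c) (swapCopies σ (.inr i)) := by
  classical
  refine iSup_le fun l => ?_
  set F := E l ((z ∘ swapCopies σ) ∘ .inl)
  have hF : (z ⁻¹' F).toFinset ∈ traces C z := mem_traces.2 ⟨F, hE _ _, Set.coe_toFinset _⟩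
  refine le_trans (le_of_eq ?_) (Finset.single_le_sum (fun _ _ => zero_le) hF)
  rw [Set.coe_toFinset]
  rfl

theorem pow_mul_sum_symWeight_comp_swapCopies_le [DecidableEq κ] {C : Set (Set Z)} {d : ℕ}
    (hC : VCBound C d) {R : Set Z} (hR : ∀ c ∈ C, c ⊆ R) {θ : ℝ≥0∞} (hθ : θ ≤ 1) {a c : ℝ≥0∞}
    (hac : a + c ≤ 1) {E : ι → (κ → Z) → Set Z} (hE : ∀ l S, E l S ∈ C) (z : κ ⊕ κ → Z) :
    θ ^ d * ∑ σ : κ → Bool, symWeight a c E (z ∘ swapCopies σ) ≤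
      2 ^ Fintype.card κ * ∏ p, R.mulIndicator (fun _ => 1 + θ) (z p) := by
  calc θ ^ d * ∑ σ : κ → Bool, symWeight a c E (z ∘ swapCopies σ)
      ≤ θ ^ d * ∑ σ : κ → Bool, ∑ B ∈ traces C z,
          ∏ i, (B : Set (κ ⊕ κ)).mulIndicator (fun _ => a) (swapCopies σ (.inl i)) *
            (B : Set (κ ⊕ κ)).mulIndicator (fun _ => 1 + c) (swapCopies σ (.inr i)) := by
        gcongr with σ _
        exact symWeight_comp_swapCopies_le hE a c z σ
    _ ≤ θ ^ d * ∑ _B ∈ traces C z, 2 ^ Fintype.card κ := by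
        rw [Finset.sum_comm]
        gcongr with B
        exact sum_prod_swapCopies_le fun i => mulIndicator_mul_add_le_two hac _ _ _
    _ = 2 ^ Fintype.card κ * (θ ^ d * (traces C z).card) := by
        rw [Finset.sum_const, nsmul_eq_mul]
        ring
    _ ≤ 2 ^ Fintype.card κ * ∏ p, R.mulIndicator (fun _ => 1 + θ) (z p) := by
        gcongr
        exact hC.pow_mul_card_traces_le hR hθ z

end Symmetrization

section RelativeDeviation

variable {κ ι Z : Type*} [Fintype κ]

theorem prod_mulIndicator_const {M : Type*} [CommMonoid M] (F : Set Z) (a : M) (S : κ → Z) :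
    ∏ i, F.mulIndicator (fun _ => a) (S i) = a ^ (S ⁻¹' F).ncard := by
  classical
  simp only [Set.mulIndicator_apply, Finset.prod_ite, Finset.prod_const_one, mul_one,
    Finset.prod_const, Set.ncard_eq_toFinset_card']
  congr 2
  ext i
  simp only [Finset.mem_filter, Finset.mem_univ, true_and, Set.mem_toFinset, Set.mem_preimage]

theorem exp_div_three_le {q : ℝ} (h0 : 0 ≤ q) (h1 : q ≤ 1) : Real.exp (q / 3) ≤ 1 + q / 2 := by
  have hpos : 0 < 1 + q / 2 := by linarith
  rw [← Real.le_log_iff_exp_le hpos]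
  refine le_trans ?_ (Real.one_sub_inv_le_log_of_pos hpos)
  rw [le_sub_iff_add_le, ← le_sub_iff_add_le', inv_le_comm₀ hpos (by linarith), inv_eq_one_div,
    div_le_iff₀ (by linarith)]
  nlinarith

theorem ofReal_exp_add (u v : ℝ) : ENNReal.ofReal (Real.exp (u + v)) =
    ENNReal.ofReal (Real.exp u) * ENNReal.ofReal (Real.exp v) := by
  rw [Real.exp_add, ENNReal.ofReal_mul (Real.exp_pos u).le]

variable [MeasurableSpace Z]

theorem measurable_mulIndicator_const {F : Set Z} (hF : MeasurableSet F) (a : ℝ≥0∞) :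
    Measurable (F.mulIndicator fun _ => a) := by
  classical
  exact measurable_const.piecewise hF measurable_const

theorem measurable_mulIndicator_comp {Ω : Type*} [MeasurableSpace Ω] {E : Ω → Set Z}
    (hE : MeasurableSet {p : Ω × Z | p.2 ∈ E p.1}) (a : ℝ≥0∞) {g : Ω → Z} (hg : Measurable g) :
    Measurable fun ω => (E ω).mulIndicator (fun _ => a) (g ω) :=
  (measurable_mulIndicator_const hE a).comp (measurable_id.prodMk hg)

theorem measurable_symWeight [Countable ι] {E : ι → (κ → Z) → Set Z}
    (hE : ∀ l, MeasurableSet {p : (κ → Z) × Z | p.2 ∈ E l p.1}) (a c : ℝ≥0∞) :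
    Measurable (symWeight a c E) := by
  have hsample : Measurable fun z : κ ⊕ κ → Z => z ∘ Sum.inl :=
    measurable_pi_lambda _ fun i => measurable_pi_apply (Sum.inl i)
  have hE' : ∀ l, MeasurableSet {p : (κ ⊕ κ → Z) × Z | p.2 ∈ E l (p.1 ∘ .inl)} := fun l =>
    (hE l).preimage ((hsample.comp measurable_fst).prodMk measurable_snd)
  exact Measurable.iSup fun l => Finset.measurable_prod _ fun i _ =>
    (measurable_mulIndicator_comp (hE' l) _ (measurable_pi_apply _)).mul
      (measurable_mulIndicator_comp (hE' l) _ (measurable_pi_apply _))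

variable (μ : Measure Z) [IsProbabilityMeasure μ]

theorem lintegral_mulIndicator_one_add {F : Set Z} (hF : MeasurableSet F) (c : ℝ≥0∞) :
    ∫⁻ x, F.mulIndicator (fun _ => 1 + c) x ∂μ = 1 + c * μ F := by
  classical
  have h : ∀ x, F.mulIndicator (fun _ => 1 + c) x = 1 + F.indicator (fun _ => c) x := by
    intro x
    by_cases hx : x ∈ F <;> simp [hx]
  simp only [h]
  rw [lintegral_add_left measurable_const, lintegral_indicator_const hF, lintegral_const,
    measure_univ, mul_one]

theorem lintegral_pi_prod_mulIndicator {F : Set Z} (hF : MeasurableSet F) (c : ℝ≥0∞) :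
    ∫⁻ z, ∏ i, F.mulIndicator (fun _ => 1 + c) (z i) ∂(Measure.pi fun _ : κ => μ) =
      (1 + c * μ F) ^ Fintype.card κ := by
  rw [lintegral_pi_prod μ (measurable_mulIndicator_const hF _), lintegral_mulIndicator_one_add μ hF]

theorem pow_mul_lintegral_symWeight_le [Countable ι] {C : Set (Set Z)} {d : ℕ} (hC : VCBound C d)
    {R : Set Z} (hRm : MeasurableSet R) (hR : ∀ c ∈ C, c ⊆ R) {θ : ℝ≥0∞} (hθ : θ ≤ 1)
    {a c : ℝ≥0∞} (hac : a + c ≤ 1) {E : ι → (κ → Z) → Set Z} (hE : ∀ l S, E l S ∈ C)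
    (hEm : ∀ l, MeasurableSet {p : (κ → Z) × Z | p.2 ∈ E l p.1}) :
    θ ^ d * ∫⁻ z, symWeight a c E z ∂(Measure.pi fun _ => μ) ≤
      (1 + θ * μ R) ^ (2 * Fintype.card κ) := by
  classical
  have hW := measurable_symWeight hEm a c
  have hswap : ∀ σ : κ → Bool, MeasurePreserving (fun z : κ ⊕ κ → Z => z ∘ swapCopies σ)
      (Measure.pi fun _ => μ) (Measure.pi fun _ => μ) := fun σ =>
    measurePreserving_arrowCongr' _ _ (swapCopies σ).symm (.refl Z) fun _ => .id μ
  refine (ENNReal.mul_le_mul_iff_right (a := 2 ^ Fintype.card κ) (by positivity)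
    (by finiteness)).1 ?_
  calc 2 ^ Fintype.card κ * (θ ^ d * ∫⁻ z, symWeight a c E z ∂(Measure.pi fun _ => μ))
      = θ ^ d * ∑ σ : κ → Bool,
          ∫⁻ z, symWeight a c E (z ∘ swapCopies σ) ∂(Measure.pi fun _ => μ) := by
        simp only [(hswap _).lintegral_comp hW, Finset.sum_const, Finset.card_univ, nsmul_eq_mul,
          Fintype.card_fun, Fintype.card_bool, Nat.cast_pow, Nat.cast_ofNat]
        ring
    _ = ∫⁻ z, θ ^ d * ∑ σ : κ → Bool, symWeight a c E (z ∘ swapCopies σ)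
          ∂(Measure.pi fun _ => μ) := by
        have hWσ : ∀ σ : κ → Bool, Measurable fun z => symWeight a c E (z ∘ swapCopies σ) :=
          fun σ => hW.comp (hswap σ).measurable
        rw [lintegral_const_mul _ (Finset.measurable_fun_sum _ fun σ _ => hWσ σ),
          lintegral_finsetSum _ fun σ _ => hWσ σ]
    _ ≤ ∫⁻ z, 2 ^ Fintype.card κ * ∏ p, R.mulIndicator (fun _ => 1 + θ) (z p)
          ∂(Measure.pi fun _ => μ) :=
        lintegral_mono fun z => pow_mul_sum_symWeight_comp_swapCopies_le hC hR hθ hac hE z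
    _ = 2 ^ Fintype.card κ * (1 + θ * μ R) ^ (2 * Fintype.card κ) := by
        rw [lintegral_const_mul' _ _ (by finiteness), lintegral_pi_prod_mulIndicator μ hRm,
          Fintype.card_sum, two_mul]

/-- The symmetrised weight of the sample `S` after averaging over the ghost sample. -/
def ghostAverage (a c : ℝ≥0∞) (E : ι → (κ → Z) → Set Z) (S : κ → Z) : ℝ≥0∞ :=
  ⨆ l, (∏ i, (E l S).mulIndicator (fun _ => a) (S i)) * (1 + c * μ (E l S)) ^ Fintype.card κ

theorem measurable_ghostAverage [Countable ι] {E : ι → (κ → Z) → Set Z}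
    (hE : ∀ l, MeasurableSet {p : (κ → Z) × Z | p.2 ∈ E l p.1}) (a c : ℝ≥0∞) :
    Measurable (ghostAverage μ a c E) := by
  refine Measurable.iSup fun l => Measurable.mul ?_ ?_
  · exact Finset.measurable_prod _ fun i _ =>
      measurable_mulIndicator_comp (hE l) a (measurable_pi_apply i)
  · exact (((measurable_measure_prodMk_left (hE l)).const_mul c).const_add 1).pow_const _

theorem lintegral_ghostAverage_le [Countable ι] {E : ι → (κ → Z) → Set Z}
    (hE : ∀ l, MeasurableSet {p : (κ → Z) × Z | p.2 ∈ E l p.1}) (a c : ℝ≥0∞) :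
    ∫⁻ S, ghostAverage μ a c E S ∂(Measure.pi fun _ => μ) ≤
      ∫⁻ z, symWeight a c E z ∂(Measure.pi fun _ => μ) := by
  have hsplit := measurePreserving_sumPiEquivProdPi_symm fun _ : κ ⊕ κ => μ
  have hW := measurable_symWeight hE a c
  rw [← hsplit.lintegral_comp hW, lintegral_prod (fun p => symWeight a c E _)
    (hW.comp hsplit.measurable).aemeasurable]
  refine lintegral_mono fun S => iSup_le fun l => ?_
  have hES : MeasurableSet (E l S) := (hE l).preimage measurable_prodMk_left
  have hm : Measurable fun S' : κ → Z => ∏ i, (E l S).mulIndicator (fun _ => 1 + c) (S' i) :=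
    Finset.measurable_prod _ fun i _ =>
      (measurable_mulIndicator_const hES _).comp (measurable_pi_apply i)
  rw [← lintegral_pi_prod_mulIndicator μ hES, ← lintegral_const_mul _ hm]
  refine lintegral_mono fun S' => ?_
  rw [← Finset.prod_mul_distrib]
  exact le_iSup (fun l => ∏ i, (E l S).mulIndicator (fun _ => a) (S i) *
    (E l S).mulIndicator (fun _ => 1 + c) (S' i)) l

theorem ofReal_exp_mul_sub_ncard_le (F : Set Z) (S : κ → Z) :
    ENNReal.ofReal (Real.exp (Fintype.card κ * μ.real F / 3 - (S ⁻¹' F).ncard)) ≤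
      (∏ i, F.mulIndicator (fun _ => ENNReal.ofReal (Real.exp (-1))) (S i)) *
        (1 + ENNReal.ofReal 2⁻¹ * μ F) ^ Fintype.card κ := by
  set n := Fintype.card κ
  have hF : 1 + ENNReal.ofReal 2⁻¹ * μ F = ENNReal.ofReal (1 + μ.real F / 2) := by
    rw [← ofReal_measureReal, ← ENNReal.ofReal_mul (by norm_num), ← ENNReal.ofReal_one,
      ← ENNReal.ofReal_add zero_le_one (by positivity), inv_mul_eq_div]
  rw [prod_mulIndicator_const, hF, ← ENNReal.ofReal_pow (by positivity),
    ← ENNReal.ofReal_pow (by positivity), ← ENNReal.ofReal_mul (by positivity)]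
  refine ENNReal.ofReal_le_ofReal ?_
  calc Real.exp (n * μ.real F / 3 - (S ⁻¹' F).ncard)
      = Real.exp (-1) ^ (S ⁻¹' F).ncard * Real.exp (μ.real F / 3) ^ n := by
        rw [← Real.exp_nat_mul, ← Real.exp_nat_mul, ← Real.exp_add]
        ring_nf
    _ ≤ Real.exp (-1) ^ (S ⁻¹' F).ncard * (1 + μ.real F / 2) ^ n := by
        gcongr
        exact exp_div_three_le measureReal_nonneg measureReal_le_one

theorem one_add_mul_measure_pow_le {θ : ℝ} (hθ : 0 ≤ θ) (R : Set Z) (n : ℕ) :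
    (1 + ENNReal.ofReal θ * μ R) ^ n ≤ ENNReal.ofReal (Real.exp (n * θ * μ.real R)) := by
  rw [← ofReal_measureReal, ← ENNReal.ofReal_mul hθ, ← ENNReal.ofReal_one,
    ← ENNReal.ofReal_add zero_le_one (by positivity), ← ENNReal.ofReal_pow (by positivity),
    mul_assoc, Real.exp_nat_mul]
  gcongr
  rw [add_comm]
  exact Real.add_one_le_exp _

theorem lintegral_ghostAverage_le_exp [Countable ι] {C : Set (Set Z)} {d : ℕ} (hC : VCBound C d)
    {R : Set Z} (hRm : MeasurableSet R) (hR : ∀ c ∈ C, c ⊆ R) {θ : ℝ} (hθ0 : 0 < θ) (hθ1 : θ ≤ 1)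
    {a c : ℝ≥0∞} (hac : a + c ≤ 1) {E : ι → (κ → Z) → Set Z} (hE : ∀ l S, E l S ∈ C)
    (hEm : ∀ l, MeasurableSet {p : (κ → Z) × Z | p.2 ∈ E l p.1}) :
    ∫⁻ S, ghostAverage μ a c E S ∂(Measure.pi fun _ => μ) ≤
      ENNReal.ofReal (Real.exp (d * Real.log θ⁻¹ + 2 * Fintype.card κ * θ * μ.real R)) := by
  have hθd : ENNReal.ofReal θ ^ d = ENNReal.ofReal (Real.exp (-(d * Real.log θ⁻¹))) := by
    rw [← ENNReal.ofReal_pow hθ0.le, Real.log_inv, mul_neg, neg_neg, Real.exp_nat_mul,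
      Real.exp_log hθ0]
  calc ∫⁻ S, ghostAverage μ a c E S ∂(Measure.pi fun _ => μ)
      ≤ ∫⁻ z, symWeight a c E z ∂(Measure.pi fun _ => μ) := lintegral_ghostAverage_le μ hEm a c
    _ = ENNReal.ofReal (Real.exp (d * Real.log θ⁻¹)) *
          (ENNReal.ofReal θ ^ d * ∫⁻ z, symWeight a c E z ∂(Measure.pi fun _ => μ)) := by
        rw [hθd, ← mul_assoc, ← ofReal_exp_add, add_neg_cancel, Real.exp_zero, ENNReal.ofReal_one,
          one_mul]
    _ ≤ ENNReal.ofReal (Real.exp (d * Real.log θ⁻¹)) *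
          (1 + ENNReal.ofReal θ * μ R) ^ (2 * Fintype.card κ) := by
        gcongr
        exact pow_mul_lintegral_symWeight_le μ hC hRm hR (ENNReal.ofReal_le_one.2 hθ1) hac hE hEm
    _ ≤ _ := by
        rw [ofReal_exp_add]
        gcongr
        simpa only [Nat.cast_mul, Nat.cast_ofNat] using
          one_add_mul_measure_pow_le μ hθ0.le R (2 * Fintype.card κ)

/-- Relative deviations with the usual `d * log n` replaced by a multiple of `d`, at the price of
the term in `R`. -/
theorem measure_exists_ncard_lt_le [Countable ι] {C : Set (Set Z)} {d : ℕ} (hC : VCBound C d)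
    {R : Set Z} (hRm : MeasurableSet R) (hR : ∀ c ∈ C, c ⊆ R) {θ : ℝ} (hθ0 : 0 < θ) (hθ1 : θ ≤ 1)
    {E : ι → (κ → Z) → Set Z} (hE : ∀ l S, E l S ∈ C)
    (hEm : ∀ l, MeasurableSet {p : (κ → Z) × Z | p.2 ∈ E l p.1}) (L : ℝ) :
    Measure.pi (fun _ : κ => μ) {S | ∃ l, (S ⁻¹' E l S).ncard + d * Real.log θ⁻¹ +
      2 * Fintype.card κ * θ * μ.real R + L < Fintype.card κ * μ.real (E l S) / 3} ≤
      ENNReal.ofReal (Real.exp (-L)) := by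
  set n := Fintype.card κ
  set a : ℝ≥0∞ := ENNReal.ofReal (Real.exp (-1))
  set c : ℝ≥0∞ := ENNReal.ofReal 2⁻¹
  have hac : a + c ≤ 1 := by
    rw [← ENNReal.ofReal_add (by positivity) (by norm_num), ENNReal.ofReal_le_one]
    linarith [Real.exp_neg_one_lt_d9]
  have hmoment := lintegral_ghostAverage_le_exp μ hC hRm hR hθ0 hθ1 hac hE hEm
  set K : ℝ := d * Real.log θ⁻¹ + 2 * n * θ * μ.real R
  have hmarkov := mul_meas_ge_le_lintegral (μ := Measure.pi fun _ : κ => μ)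
    (measurable_ghostAverage μ hEm a c) (ENNReal.ofReal (Real.exp (K + L)))
  set B := {S | ENNReal.ofReal (Real.exp (K + L)) ≤ ghostAverage μ a c E S}
  calc _ ≤ Measure.pi (fun _ : κ => μ) B := by
        refine measure_mono ?_
        rintro S ⟨l, hl⟩
        refine le_trans (ENNReal.ofReal_le_ofReal (Real.exp_le_exp.2 ?_))
          ((ofReal_exp_mul_sub_ncard_le μ (E l S) S).trans (le_iSup (fun l =>
            (∏ i, (E l S).mulIndicator (fun _ => a) (S i)) * (1 + c * μ (E l S)) ^ n) l))
        linarith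
    _ = ENNReal.ofReal (Real.exp (-(K + L))) *
          (ENNReal.ofReal (Real.exp (K + L)) * Measure.pi (fun _ : κ => μ) B) := by
        rw [← mul_assoc, ← ofReal_exp_add, neg_add_cancel, Real.exp_zero, ENNReal.ofReal_one,
          one_mul]
    _ ≤ ENNReal.ofReal (Real.exp (-(K + L))) * ENNReal.ofReal (Real.exp K) :=
        mul_le_mul_right (hmarkov.trans hmoment) _
    _ = ENNReal.ofReal (Real.exp (-L)) := by
        rw [← ofReal_exp_add, neg_add_rev, neg_add_cancel_right]

end RelativeDeviation

section Split

variable {Z : Type*}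

/-- The part of the `i`-th block of `S` on which `split (j + 6) S T` recurses. -/
def blockHead (j i : ℕ) (S : List Z) : List Z :=
  ((S.drop (i * 3 ^ (j + 3))).take (3 ^ (j + 3))).take (3 ^ j)

/-- The part of the `i`-th block of `S` that `split (j + 6) S T` puts in front of `T`. -/
def blockTail (j i : ℕ) (S : List Z) : List Z :=
  ((S.drop (i * 3 ^ (j + 3))).take (3 ^ (j + 3))).drop (3 ^ j)

theorem split_of_lt {k : ℕ} (hk : k < 6) (S T : List Z) : split k S T = [S ++ T] := by
  rw [split, if_neg hk.not_ge]

theorem split_add_six (j : ℕ) (S T : List Z) : split (j + 6) S T =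
    (List.range 27).flatMap fun i => split j (blockHead j i S) (blockTail j i S ++ T) := by
  rw [split, if_pos (Nat.le_add_left 6 j)]
  rfl

theorem mem_split_add_six {j : ℕ} {S T S' : List Z} : S' ∈ split (j + 6) S T ↔
    ∃ i : Fin 27, S' ∈ split j (blockHead j i S) (blockTail j i S ++ T) := by
  simp only [split_add_six, List.mem_flatMap, List.mem_range, Fin.exists_iff, exists_prop]

theorem split_induction {motive : ℕ → Prop} (k : ℕ) (base : ∀ k < 6, motive k)
    (step : ∀ j, motive j → motive (j + 6)) : motive k := by
  induction k using Nat.strong_induction_on with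
  | _ k ih =>
    rcases lt_or_ge k 6 with hk | hk
    · exact base k hk
    · obtain ⟨j, rfl⟩ := Nat.exists_eq_add_of_le' hk
      exact step j (ih j (by lia))

theorem length_split (k : ℕ) (S T : List Z) : (split k S T).length = 27 ^ (k / 6) := by
  induction k using split_induction generalizing S T with
  | base k hk => rw [split_of_lt hk, Nat.div_eq_of_lt hk, List.length_singleton, pow_zero]
  | step j ih =>
    rw [split_add_six, List.length_flatMap, Nat.add_div_right j (by norm_num), pow_succ']
    simp only [ih, List.map_const', List.length_range, List.sum_replicate, smul_eq_mul]

theorem split_map {Y : Type*} (f : Y → Z) (k : ℕ) (S T : List Y) :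
    split k (S.map f) (T.map f) = (split k S T).map (List.map f) := by
  induction k using split_induction generalizing S T with
  | base k hk => rw [split_of_lt hk, split_of_lt hk, List.map_singleton, List.map_append]
  | step j ih =>
    simp only [split_add_six, List.map_flatMap, ← ih, blockHead, blockTail, List.map_append,
      List.map_take, List.map_drop]

theorem mem_or_mem_of_mem_split {k : ℕ} {S T S' : List Z} (h : S' ∈ split k S T) {x : Z}
    (hx : x ∈ S') : x ∈ S ∨ x ∈ T := by
  induction k using split_induction generalizing S T S' with
  | base k hk =>
    rw [split_of_lt hk, List.mem_singleton] at h
    exact List.mem_append.1 (h ▸ hx)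
  | step j ih =>
    have hblock {i : ℕ} (hxi : x ∈ (S.drop (i * 3 ^ (j + 3))).take (3 ^ (j + 3))) : x ∈ S :=
      List.mem_of_mem_drop (List.mem_of_mem_take hxi)
    obtain ⟨i, hi⟩ := mem_split_add_six.1 h
    rcases ih hi hx with hhead | htail
    · exact .inl (hblock (List.mem_of_mem_take hhead))
    · exact (List.mem_append.1 htail).imp_left fun hx => hblock (List.mem_of_mem_drop hx)

theorem suffix_of_mem_split {k : ℕ} {S T S' : List Z} (h : S' ∈ split k S T) : T <:+ S' := by
  induction k using split_induction generalizing S T S' with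
  | base k hk =>
    rw [split_of_lt hk, List.mem_singleton] at h
    exact h ▸ List.suffix_append S T
  | step j ih =>
    obtain ⟨i, hi⟩ := mem_split_add_six.1 h
    exact (List.suffix_append _ _).trans (ih hi)

/-- The positions in a sequence of length `3 ^ (j + 6)`, sorted by block and by head or tail. -/
def blockEquiv (j : ℕ) : Fin 27 × (Fin (3 ^ j) ⊕ Fin (26 * 3 ^ j)) ≃ Fin (3 ^ (j + 6)) :=
  ((Equiv.refl _).prodCongr finSumFinEquiv).trans
    (finProdFinEquiv.trans (finCongr (by rw [pow_add]; ring)))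

/-- The positions of the entries of the head of the `i`-th block. -/
def headIndex (j : ℕ) (i : Fin 27) (a : Fin (3 ^ j)) : Fin (3 ^ (j + 6)) :=
  blockEquiv j (i, .inl a)

/-- The positions of the entries of the tail of the `i`-th block. -/
def tailIndex (j : ℕ) (i : Fin 27) (a : Fin (26 * 3 ^ j)) : Fin (3 ^ (j + 6)) :=
  blockEquiv j (i, .inr a)

theorem headIndex_injective (j : ℕ) (i : Fin 27) : Function.Injective (headIndex j i) :=
  (blockEquiv j).injective.comp ((Prod.mk_right_injective i).comp Sum.inl_injective)

theorem tailIndex_injective (j : ℕ) (i : Fin 27) : Function.Injective (tailIndex j i) :=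
  (blockEquiv j).injective.comp ((Prod.mk_right_injective i).comp Sum.inr_injective)

theorem coe_headIndex (j : ℕ) (i : Fin 27) (a : Fin (3 ^ j)) :
    (headIndex j i a : ℕ) = i * 3 ^ (j + 3) + a := by
  simp only [headIndex, blockEquiv, Equiv.trans_apply, Equiv.prodCongr_apply, Prod.map_apply,
    Equiv.refl_apply, finSumFinEquiv_apply_left, finCongr_apply, Fin.val_cast,
    finProdFinEquiv_apply_val, Fin.val_castAdd]
  ring

theorem coe_tailIndex (j : ℕ) (i : Fin 27) (a : Fin (26 * 3 ^ j)) :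
    (tailIndex j i a : ℕ) = i * 3 ^ (j + 3) + (3 ^ j + a) := by
  simp only [tailIndex, blockEquiv, Equiv.trans_apply, Equiv.prodCongr_apply, Prod.map_apply,
    Equiv.refl_apply, finSumFinEquiv_apply_right, finCongr_apply, Fin.val_cast,
    finProdFinEquiv_apply_val, Fin.val_natAdd]
  ring

theorem blockHead_ofFn (j : ℕ) (i : Fin 27) (z : Fin (3 ^ (j + 6)) → Z) :
    blockHead j i (List.ofFn z) = List.ofFn fun a => z (headIndex j i a) := by
  have hlength : (List.ofFn fun a => z (headIndex j i a)).length =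
      (blockHead j i (List.ofFn z)).length := by
    have h3 : 3 ^ (j + 3) = 27 * 3 ^ j := by ring
    have h6 : 3 ^ (j + 6) = 729 * 3 ^ j := by ring
    have hi : (i : ℕ) * 3 ^ (j + 3) ≤ 26 * 3 ^ (j + 3) := Nat.mul_le_mul_right _ (by lia)
    simp only [blockHead, List.length_take, List.length_drop, List.length_ofFn]
    omega
  refine List.ext_getElem hlength.symm fun n _ _ => ?_
  simp only [blockHead, List.getElem_take, List.getElem_drop, List.getElem_ofFn]
  exact congrArg z (Fin.ext (coe_headIndex j i ⟨n, _⟩).symm)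

theorem blockTail_ofFn (j : ℕ) (i : Fin 27) (z : Fin (3 ^ (j + 6)) → Z) :
    blockTail j i (List.ofFn z) = List.ofFn fun a => z (tailIndex j i a) := by
  have hlength : (List.ofFn fun a => z (tailIndex j i a)).length =
      (blockTail j i (List.ofFn z)).length := by
    have h3 : 3 ^ (j + 3) = 27 * 3 ^ j := by ring
    have h6 : 3 ^ (j + 6) = 729 * 3 ^ j := by ring
    have hi : (i : ℕ) * 3 ^ (j + 3) ≤ 26 * 3 ^ (j + 3) := Nat.mul_le_mul_right _ (by lia)
    simp only [blockTail, List.length_take, List.length_drop, List.length_ofFn]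
    omega
  refine List.ext_getElem hlength.symm fun n _ _ => ?_
  simp only [blockTail, List.getElem_take, List.getElem_drop, List.getElem_ofFn]
  exact congrArg z (Fin.ext (coe_tailIndex j i ⟨n, _⟩).symm)

section Extend

variable (j : ℕ) (i : Fin 27) (z : Fin (3 ^ (j + 6)) → Z)

theorem blockHead_ofFn_extend_headIndex (s : Fin (3 ^ j) → Z) :
    blockHead j i (List.ofFn (Function.extend (headIndex j i) s z)) = List.ofFn s := by
  simp only [blockHead_ofFn, (headIndex_injective j i).extend_apply]

theorem blockTail_ofFn_extend_tailIndex (s : Fin (26 * 3 ^ j) → Z) :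
    blockTail j i (List.ofFn (Function.extend (tailIndex j i) s z)) = List.ofFn s := by
  simp only [blockTail_ofFn, (tailIndex_injective j i).extend_apply]

theorem blockTail_ofFn_extend_headIndex (s : Fin (3 ^ j) → Z) :
    blockTail j i (List.ofFn (Function.extend (headIndex j i) s z)) =
      blockTail j i (List.ofFn z) := by
  rw [blockTail_ofFn, blockTail_ofFn]
  refine congrArg List.ofFn (funext fun a => Function.extend_apply' _ _ _ ?_)
  simp [headIndex, tailIndex]

theorem blockHead_ofFn_extend_tailIndex (i' : Fin 27) (s : Fin (26 * 3 ^ j) → Z) :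
    blockHead j i' (List.ofFn (Function.extend (tailIndex j i) s z)) =
      blockHead j i' (List.ofFn z) := by
  rw [blockHead_ofFn, blockHead_ofFn]
  refine congrArg List.ofFn (funext fun a => Function.extend_apply' _ _ _ ?_)
  simp [headIndex, tailIndex]

variable {i} in
theorem blockTail_ofFn_extend_tailIndex_of_ne {i' : Fin 27} (hi : i ≠ i')
    (s : Fin (26 * 3 ^ j) → Z) :
    blockTail j i' (List.ofFn (Function.extend (tailIndex j i) s z)) =
      blockTail j i' (List.ofFn z) := by
  rw [blockTail_ofFn, blockTail_ofFn]
  refine congrArg List.ofFn (funext fun a => Function.extend_apply' _ _ _ ?_)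
  simp [tailIndex, hi]

end Extend

theorem exists_subsample_sublist_mem_split (k : ℕ) : ∃ (n : ℕ) (e : Fin n → Fin (3 ^ k)),
    Function.Injective e ∧ 3 ^ k ≤ 29 * n ∧ ∀ (z : Fin (3 ^ k) → Z) (T : List Z),
      ∃ S' ∈ split k (List.ofFn z) T, (List.ofFn (z ∘ e)).Sublist S' := by
  induction k using split_induction with
  | base k hk =>
    refine ⟨3 ^ k, id, Function.injective_id, by lia, fun z T => ⟨List.ofFn z ++ T, ?_, ?_⟩⟩
    · rw [split_of_lt hk, List.mem_singleton]
    · exact List.sublist_append_left _ T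
  | step k _ =>
    refine ⟨26 * 3 ^ k, tailIndex k 0, tailIndex_injective k 0, by rw [pow_add]; lia,
      fun z T => ?_⟩
    obtain ⟨S', hS'⟩ := List.exists_mem_of_ne_nil _ (split_ne_nil k
      (blockHead k (0 : Fin 27) (List.ofFn z)) (blockTail k (0 : Fin 27) (List.ofFn z) ++ T))
    refine ⟨S', mem_split_add_six.2 ⟨0, hS'⟩, ?_⟩
    rw [Function.comp_def, ← blockTail_ofFn]
    exact (List.sublist_append_left _ _).trans (suffix_of_mem_split hS').sublist

end Split

section Errors

theorem countP_ofFn {Z : Type*} {n : ℕ} (f : Fin n → Z) (p : Z → Prop) [DecidablePred p] :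
    (List.ofFn f).countP p = (Finset.univ.filter fun i => p (f i)).card := by
  rw [List.ofFn_eq_map, List.countP_map, Finset.card_def, Finset.filter_val,
    ← Multiset.countP_eq_card_filter]
  exact (Multiset.coe_countP _ _).symm

variable {X : Type*}

/-- The set of the examples on which `h` errs. -/
def errSet (h : Hypothesis X) : Set (Example X) := {z | h z.1 ≠ z.2}

theorem errCount_le_of_sublist (h : Hypothesis X) {S T : List (Example X)} (hST : S.Sublist T) :
    errCount h S ≤ errCount h T :=
  hST.countP_le

theorem errCount_ofFn (h : Hypothesis X) {n : ℕ} (z : Fin n → Example X) :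
    errCount h (List.ofFn z) = (z ⁻¹' errSet h).ncard := by
  classical
  rw [errCount, countP_ofFn, ← Set.ncard_coe_finset, Finset.coe_filter_univ]
  rfl

variable {H : Set (Hypothesis X)}

theorem IsERM.errCount_le {A : Learner X} (hA : IsERM H A) {h : Hypothesis X} (hh : h ∈ H)
    (S : List (Example X)) : errCount (A S) S ≤ errCount h S := by
  rcases eq_or_ne S [] with rfl | hS
  · rfl
  · have hemp := (hA S).2 h hh
    rw [empError, empError, div_le_div_iff_of_pos_right
      (Nat.cast_pos.2 (List.length_pos_of_ne_nil hS))] at hemp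
    exact_mod_cast hemp

theorem Shatters.card_le {s : Finset X} (hs : Shatters H s) {d : ℕ} (hd : vcDim H ≤ d) :
    s.card ≤ d := by
  exact_mod_cast
    (le_iSup (fun s : {s : Finset X // Shatters H s} => (s.1.card : ℕ∞)) ⟨s, hs⟩).trans hd

theorem Label.eq_of_ne_of_ne {a b y : Label} (ha : a ≠ y) (hb : b ≠ y) : a = b := by
  decide +revert

theorem vcBound_image_inter_errSet {d : ℕ} (hd : vcDim H ≤ d) (R : Set (Example X)) :
    VCBound ((fun h => R ∩ errSet h) '' H) d := by
  classical
  intro w hw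
  have hwR : ∀ z ∈ w, z ∈ R := by
    obtain ⟨-, ⟨h, -, rfl⟩, hc⟩ := hw w subset_rfl
    exact fun z hz => ((hc z hz).2 hz).1
  have herr : ∀ t ⊆ w, ∃ h ∈ H, ∀ z ∈ w, h z.1 ≠ z.2 ↔ z ∈ t := by
    intro t ht
    obtain ⟨-, ⟨h, hh, rfl⟩, hc⟩ := hw t ht
    exact ⟨h, hh, fun z hz => by rw [← hc z hz]; exact (and_iff_right (hwR z hz)).symm⟩
  have hinj : Set.InjOn Prod.fst (w : Set (Example X)) := by
    rintro ⟨x, y⟩ hz ⟨x', y'⟩ hz' (rfl : x = x')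
    obtain ⟨h, -, hh⟩ := herr w subset_rfl
    exact Prod.ext rfl
      (Label.eq_of_ne_of_ne ((hh _ hz).2 hz).symm ((hh _ hz').2 hz').symm)
  rw [← Finset.card_image_of_injOn hinj]
  refine Shatters.card_le (fun f => ?_) hd
  obtain ⟨h, hh, hhw⟩ := herr (w.filter fun z => f z.1 ≠ z.2) (Finset.filter_subset _ _)
  refine ⟨h, hh, Finset.forall_mem_image.2 fun z hz => ?_⟩
  have hiff : h z.1 ≠ z.2 ↔ f z.1 ≠ z.2 := by rw [hhw z hz, Finset.mem_filter, and_iff_right hz]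
  by_cases hf : f z.1 = z.2
  · exact (not_not.1 (hiff.not.2 (not_not.2 hf))).trans hf.symm
  · exact Label.eq_of_ne_of_ne (hiff.2 hf) hf

theorem eq_of_vcDim_le_zero (hd : vcDim H ≤ (0 : ℕ)) {g h : Hypothesis X} (hg : g ∈ H)
    (hh : h ∈ H) : g = h := by
  by_contra hne
  obtain ⟨x, hx⟩ := Function.ne_iff.1 hne
  have hshatters : Shatters H {x} := by
    intro f
    by_cases hgf : g x = f x
    · exact ⟨g, hg, by simpa using hgf⟩
    · exact ⟨h, hh, by simpa using Label.eq_of_ne_of_ne hx.symm (Ne.symm hgf)⟩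
  exact absurd (hshatters.card_le hd) (by simp)

theorem avgErr_nonneg (L : List (Hypothesis X)) (z : Example X) : 0 ≤ avgErr L z :=
  div_nonneg (Nat.cast_nonneg _) (Nat.cast_nonneg _)

theorem avgErr_le_one (L : List (Hypothesis X)) (z : Example X) : avgErr L z ≤ 1 :=
  div_le_one_of_le₀ (Nat.cast_le.2 List.countP_le_length) (Nat.cast_nonneg _)

theorem avgErr_eq_sum_indicator (L : List (Hypothesis X)) (z : Example X) : avgErr L z =
    (∑ i, (errSet (L.get i)).indicator (fun _ => (1 : ℝ)) z) / L.length := by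
  classical
  have hcount := countP_ofFn L.get fun h => h z.1 ≠ z.2
  rw [List.ofFn_get] at hcount
  simp only [avgErr, hcount, Set.indicator_apply, Finset.sum_boole, errSet,
    Set.mem_ofPred_eq]

theorem avgErr_flatMap {L : ℕ → List (Hypothesis X)} {n q : ℕ} (hq : ∀ i < n, (L i).length = q)
    (z : Example X) :
    avgErr ((List.range n).flatMap L) z = (∑ i : Fin n, avgErr (L i) z) / n := by
  have hlength : ((List.range n).flatMap L).length = n * q := by
    rw [List.length_flatMap, List.map_congr_left (g := fun _ => q) (by simpa using hq),
      List.map_const', List.length_range, List.sum_replicate, smul_eq_mul]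
  have hcount : ((List.range n).flatMap L).countP (fun h => h z.1 ≠ z.2) =
      ∑ i : Fin n, (L i).countP fun h => h z.1 ≠ z.2 := by
    rw [List.countP_flatMap, ← Finset.sum_range fun i => (L i).countP fun h => h z.1 ≠ z.2]
    rfl
  rw [avgErr, hlength, hcount]
  simp only [avgErr, hq _ (Fin.is_lt _)]
  rw [← Finset.sum_div, div_div]
  push_cast
  rw [mul_comm]

/-- The ensemble that `ensemble A (j + 6) S T` contains for the `i`-th block. -/
def blockEnsemble (A : Learner X) (j i : ℕ) (S T : List (Example X)) : List (Hypothesis X) :=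
  ensemble A j (blockHead j i S) (blockTail j i S ++ T)

theorem ensemble_add_six (A : Learner X) (j : ℕ) (S T : List (Example X)) :
    ensemble A (j + 6) S T = (List.range 27).flatMap fun i => blockEnsemble A j i S T := by
  rw [ensemble, split_add_six, List.map_flatMap]
  rfl

theorem length_blockEnsemble (A : Learner X) (j i : ℕ) (S T : List (Example X)) :
    (blockEnsemble A j i S T).length = 27 ^ (j / 6) := by
  rw [blockEnsemble, ensemble, List.length_map, length_split]

theorem ensembleError_nonneg [MeasurableSpace X] (D : Measure (Example X)) (α : ℝ)
    (L : List (Hypothesis X)) : 0 ≤ ensembleError D α L :=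
  measureReal_nonneg

theorem ensembleError_le_one [MeasurableSpace X] (D : Measure (Example X)) [IsProbabilityMeasure D]
    (α : ℝ) (L : List (Hypothesis X)) : ensembleError D α L ≤ 1 :=
  measureReal_le_one

end Errors

section RandomLists

variable {Ω β γ : Type*}

/-- `L` is a random list whose length is deterministic and whose entries are random elements with
the property `P`, for instance measurability. -/
def RandomList (P : (Ω → β) → Prop) (L : Ω → List β) : Prop :=
  ∃ fs : List (Ω → β), (∀ f ∈ fs, P f) ∧ ∀ ω, L ω = fs.map fun f => f ω

variable {P : (Ω → β) → Prop}

theorem RandomList.const {T : List β} (hT : ∀ t ∈ T, P fun _ => t) : RandomList P fun _ => T :=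
  ⟨T.map fun t _ => t, List.forall_mem_map.2 hT, fun ω => by simp [Function.comp_def]⟩

theorem RandomList.ofFn {n : ℕ} {f : Fin n → Ω → β} (hf : ∀ a, P (f a)) :
    RandomList P fun ω => List.ofFn fun a => f a ω :=
  ⟨List.ofFn f, List.forall_mem_ofFn_iff.2 hf, fun ω => by rw [List.map_ofFn]; rfl⟩

theorem RandomList.append {S T : Ω → List β} (hS : RandomList P S) (hT : RandomList P T) :
    RandomList P fun ω => S ω ++ T ω := by
  obtain ⟨fs, hfs, hS⟩ := hS
  obtain ⟨ts, hts, hT⟩ := hT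
  exact ⟨fs ++ ts, List.forall_mem_append.2 ⟨hfs, hts⟩, fun ω => by
    simp only [hS, hT, List.map_append]⟩

theorem RandomList.map {Q : (Ω → γ) → Prop} {L : Ω → List β} (hL : RandomList P L) {φ : β → γ}
    (hφ : ∀ f, P f → Q fun ω => φ (f ω)) : RandomList Q fun ω => (L ω).map φ := by
  obtain ⟨fs, hfs, hL⟩ := hL
  exact ⟨fs.map fun f ω => φ (f ω), List.forall_mem_map.2 fun f hf => hφ f (hfs f hf),
    fun ω => by simp only [hL, List.map_map, Function.comp_def]⟩

theorem RandomList.split {S T : Ω → List β} (hS : RandomList P S) (hT : RandomList P T) (k : ℕ) :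
    RandomList (RandomList P) fun ω => split k (S ω) (T ω) := by
  obtain ⟨fs, hfs, hS⟩ := hS
  obtain ⟨ts, hts, hT⟩ := hT
  refine ⟨(AgnosticVC.split k fs ts).map fun gs ω => gs.map fun f => f ω,
    List.forall_mem_map.2 fun gs hgs => ⟨gs, fun f hf => ?_, fun ω => rfl⟩, fun ω => ?_⟩
  · exact (mem_or_mem_of_mem_split hgs hf).elim (hfs f) (hts f)
  · simp only [hS, hT, split_map, List.map_map, Function.comp_def]

variable {Ω' : Type*} [MeasurableSpace Ω'] {π : Ω' → Ω} {L : Ω → List β}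

theorem RandomList.measurableSet_exists_mem (hL : RandomList P L) {q : Ω' → β → Prop}
    (hq : ∀ f, P f → MeasurableSet {ω | q ω (f (π ω))}) :
    MeasurableSet {ω | ∃ b ∈ L (π ω), q ω b} := by
  obtain ⟨fs, hfs, hL⟩ := hL
  have heq : {ω | ∃ b ∈ L (π ω), q ω b} = ⋃ f ∈ {f | f ∈ fs}, {ω | q ω (f (π ω))} := by
    ext ω
    simp [hL]
  rw [heq]
  exact MeasurableSet.biUnion fs.finite_toSet.countable fun f hf => hq f (hfs f hf)

theorem RandomList.measurable_countP (hL : RandomList P L) {q : Ω' → β → Prop}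
    [∀ ω b, Decidable (q ω b)] (hq : ∀ f, P f → MeasurableSet {ω | q ω (f (π ω))}) :
    Measurable fun ω => (L (π ω)).countP fun b => q ω b := by
  obtain ⟨fs, hfs, hL⟩ := hL
  simp only [hL]
  clear hL
  induction fs with
  | nil => exact measurable_const
  | cons f fs ih =>
    obtain ⟨hf, hfs⟩ := List.forall_mem_cons.1 hfs
    simp only [List.map_cons, List.countP_cons, decide_eq_true_eq]
    exact (ih hfs).add (Measurable.ite (hq f hf) measurable_const measurable_const)

end RandomLists

section Measurability

variable {X Ω : Type*} [MeasurableSpace X] [MeasurableSpace Ω]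

/-- `h` is a random hypothesis whose prediction at `x` depends measurably on the randomness and on
`x` jointly. -/
def JointlyMeasurable (h : Ω → Hypothesis X) : Prop :=
  Measurable (Function.uncurry h)

theorem JointlyMeasurable.apply {h : Ω → Hypothesis X} (hh : JointlyMeasurable h) (ω : Ω) :
    Measurable (h ω) :=
  hh.of_uncurry_left

theorem JointlyMeasurable.const {h : Hypothesis X} (hh : Measurable h) :
    JointlyMeasurable fun _ : Ω => h :=
  hh.comp measurable_snd

theorem measurableSet_errSet {h : Hypothesis X} (hh : Measurable h) : MeasurableSet (errSet h) :=
  (measurableSet_eq_fun (hh.comp measurable_fst) measurable_snd).compl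

theorem JointlyMeasurable.measurableSet_mem_errSet {Ω' : Type*} [MeasurableSpace Ω']
    {h : Ω → Hypothesis X} (hh : JointlyMeasurable h) {π : Ω' → Ω} (hπ : Measurable π)
    {z : Ω' → Example X} (hz : Measurable z) : MeasurableSet {ω | z ω ∈ errSet (h (π ω))} :=
  (measurableSet_eq_fun (hh.comp (hπ.prodMk hz.fst)) hz.snd).compl

theorem JointlyMeasurable.measurable_errCount {h : Ω → Hypothesis X} (hh : JointlyMeasurable h)
    {S : Ω → List (Example X)} (hS : RandomList Measurable S) :
    Measurable fun ω => errCount (h ω) (S ω) :=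
  hS.measurable_countP (π := id) fun _ hf => hh.measurableSet_mem_errSet measurable_id hf

variable {L : Ω → List (Hypothesis X)}

theorem RandomList.measurable_avgErr (hL : RandomList JointlyMeasurable L) :
    Measurable fun p : Ω × Example X => avgErr (L p.1) p.2 := by
  have hcount : Measurable fun p : Ω × Example X => (L p.1).countP fun h => h p.2.1 ≠ p.2.2 :=
    hL.measurable_countP fun _ hh => hh.measurableSet_mem_errSet measurable_fst measurable_snd
  obtain ⟨fs, -, hfs⟩ := hL
  have hlength (ω : Ω) : (L ω).length = fs.length := by rw [hfs, List.length_map]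
  simp only [avgErr, hlength]
  exact (measurable_from_top.comp hcount).div_const _

theorem measurable_avgErr {L : List (Hypothesis X)} (hL : ∀ h ∈ L, Measurable h) :
    Measurable (avgErr L) := by
  have hrandom : RandomList JointlyMeasurable fun _ : Unit => L :=
    .const fun h hh => JointlyMeasurable.const (hL h hh)
  simpa only [Function.comp_def] using
    hrandom.measurable_avgErr.comp (measurable_prodMk_left (x := ()))

theorem RandomList.measurable_ensembleError (hL : RandomList JointlyMeasurable L)
    (D : Measure (Example X)) [IsProbabilityMeasure D] (α : ℝ) :
    Measurable fun ω => ensembleError D α (L ω) :=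
  (measurable_measure_prodMk_left
    (measurableSet_le measurable_const hL.measurable_avgErr)).ennreal_toReal

theorem IsMeasurableLearner.jointlyMeasurable {A : Learner X} (hA : IsMeasurableLearner A)
    {S : Ω → List (Example X)} (hS : RandomList Measurable S) :
    JointlyMeasurable fun ω => A (S ω) := by
  obtain ⟨fs, hfs, hS⟩ := hS
  have hofFn (ω : Ω) : S ω = List.ofFn fun i : Fin fs.length => fs.get i ω := by
    rw [hS, ← List.ofFn_get (fs.map _)]
    exact List.ext_getElem (by simp) fun n _ _ => by simp
  have hsample : Measurable fun p : Ω × X => ((fun i : Fin fs.length => fs.get i p.1), p.2) :=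
    (measurable_pi_lambda _ fun i =>
      (hfs _ (List.get_mem fs i)).comp measurable_fst).prodMk measurable_snd
  simp only [JointlyMeasurable, hofFn]
  exact (hA fs.length).comp hsample

theorem IsMeasurableLearner.measurable_apply {A : Learner X} (hA : IsMeasurableLearner A)
    (S : List (Example X)) : Measurable (A S) :=
  (hA.jointlyMeasurable (Ω := Unit) (S := fun _ => S)
    (.const fun _ _ => measurable_const)).apply ()

theorem IsMeasurableLearner.randomList_ensemble {A : Learner X} (hA : IsMeasurableLearner A)
    {S T : Ω → List (Example X)} (hS : RandomList Measurable S) (hT : RandomList Measurable T)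
    (k : ℕ) : RandomList JointlyMeasurable fun ω => ensemble A k (S ω) (T ω) :=
  (hS.split hT k).map fun _ => hA.jointlyMeasurable

end Measurability

section Aggregation

theorem card_mul_sub_one_le_sum_ite {ι : Type*} [Fintype ι] [DecidableEq ι] [Nonempty ι]
    {a : ι → ℝ} (h0 : ∀ i, 0 ≤ a i) (h1 : ∀ i, a i ≤ 1) {α : ℝ}
    (hα : Fintype.card ι * α ≤ ∑ i, a i) :
    Fintype.card ι * α - 1 ≤ ∑ i, ∑ j ∈ Finset.univ.erase i, if α ≤ a i then a j else 0 := by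
  obtain ⟨i, -, hi⟩ : ∃ i ∈ Finset.univ, α ≤ a i :=
    Finset.exists_le_of_sum_le Finset.univ_nonempty (by simpa using hα)
  calc Fintype.card ι * α - 1 ≤ ∑ j ∈ Finset.univ.erase i, a j := by
        linarith [h1 i, Finset.add_sum_erase Finset.univ a (Finset.mem_univ i)]
    _ = ∑ j ∈ Finset.univ.erase i, if α ≤ a i then a j else 0 := by simp only [hi, if_true]
    _ ≤ ∑ i, ∑ j ∈ Finset.univ.erase i, if α ≤ a i then a j else 0 :=
        Finset.single_le_sum
          (f := fun i => ∑ j ∈ Finset.univ.erase i, if α ≤ a i then a j else 0)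
          (fun i _ => Finset.sum_nonneg fun j _ => ite_nonneg (h0 j) le_rfl) (Finset.mem_univ i)

variable {X : Type*}

theorem mul_sub_one_le_sum_indicator_avgErr {n : ℕ} [NeZero n] {L : ℕ → List (Hypothesis X)}
    {q : ℕ} (hq : ∀ i < n, (L i).length = q) {α : ℝ} {z : Example X}
    (hz : α ≤ avgErr ((List.range n).flatMap L) z) :
    n * α - 1 ≤ ∑ i : Fin n, ∑ j ∈ Finset.univ.erase i,
      {z | α ≤ avgErr (L i) z}.indicator (avgErr (L j)) z := by
  have hsum : (n : ℝ) * α ≤ ∑ i : Fin n, avgErr (L i) z := by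
    rwa [avgErr_flatMap hq, le_div_iff₀' (Nat.cast_pos.2 (NeZero.pos n))] at hz
  simpa [Set.indicator_apply] using card_mul_sub_one_le_sum_ite
    (a := fun i : Fin n => avgErr (L i) z) (fun i => avgErr_nonneg (L i) z)
    (fun i => avgErr_le_one (L i) z) (by simpa using hsum)

variable [MeasurableSpace X] (D : Measure (Example X)) [IsProbabilityMeasure D]

theorem integrable_avgErr {L : List (Hypothesis X)} (hL : ∀ h ∈ L, Measurable h) :
    Integrable (avgErr L) D :=
  Integrable.of_bound (measurable_avgErr hL).aestronglyMeasurable 1 <| .of_forall fun z => by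
    rw [Real.norm_of_nonneg (avgErr_nonneg L z)]
    exact avgErr_le_one L z

theorem setIntegral_avgErr_le {L : List (Hypothesis X)} (hL : ∀ h ∈ L, Measurable h)
    {R : Set (Example X)} {Q : ℝ} (hQ0 : 0 ≤ Q) (hQ : ∀ h ∈ L, D.real (R ∩ errSet h) ≤ Q) :
    ∫ z in R, avgErr L z ∂D ≤ Q := by
  have hm (i : Fin L.length) : MeasurableSet (errSet (L.get i)) :=
    measurableSet_errSet (hL _ (L.get_mem i))
  have hint (i : Fin L.length) : Integrable ((errSet (L.get i)).indicator fun _ => (1 : ℝ))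
      (D.restrict R) := (integrable_const 1).indicator (hm i)
  simp only [avgErr_eq_sum_indicator]
  rw [integral_div, integral_finsetSum _ fun i _ => hint i]
  refine div_le_of_le_mul₀ (Nat.cast_nonneg _) hQ0 ?_
  calc ∑ i, ∫ z in R, (errSet (L.get i)).indicator (fun _ => (1 : ℝ)) z ∂D
      = ∑ i, D.real (R ∩ errSet (L.get i)) := by
        simp only [integral_indicator_const _ (hm _), measureReal_restrict_apply (hm _),
          smul_eq_mul, mul_one, Set.inter_comm R]
    _ ≤ ∑ _i : Fin L.length, Q := Finset.sum_le_sum fun i _ => hQ _ (L.get_mem i)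
    _ = Q * L.length := by simp [mul_comm]

theorem ensembleError_flatMap_le {n : ℕ} [NeZero n] {L : ℕ → List (Hypothesis X)} {q : ℕ}
    (hq : ∀ i < n, (L i).length = q) (hL : ∀ i : Fin n, ∀ h ∈ L i, Measurable h) {α Q : ℝ}
    (hQ0 : 0 ≤ Q)
    (hQ : ∀ i j : Fin n, i ≠ j → ∀ h ∈ L j, D.real ({z | α ≤ avgErr (L i) z} ∩ errSet h) ≤ Q) :
    (n * α - 1) * ensembleError D α ((List.range n).flatMap L) ≤ n * (n - 1) * Q := by
  let B : Set (Example X) := {z | α ≤ avgErr ((List.range n).flatMap L) z}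
  let R (i : Fin n) : Set (Example X) := {z | α ≤ avgErr (L i) z}
  have hRm (i : Fin n) : MeasurableSet (R i) :=
    measurableSet_le measurable_const (measurable_avgErr (hL i))
  have hBm : MeasurableSet B := measurableSet_le measurable_const <| measurable_avgErr <| by
    simpa only [List.mem_flatMap, List.mem_range, forall_exists_index, and_imp, Fin.forall_iff,
      forall_comm (α := Hypothesis X)] using hL
  have hint (i j : Fin n) : Integrable ((R i).indicator (avgErr (L j))) D :=
    (integrable_avgErr D (hL j)).indicator (hRm i)
  have hsum (i : Fin n) : Integrable (fun z => ∑ j ∈ Finset.univ.erase i,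
      (R i).indicator (avgErr (L j)) z) D := integrable_finsetSum _ fun j _ => hint i j
  calc (n * α - 1) * D.real B = ∫ z, B.indicator (fun _ => n * α - 1) z ∂D := by
        rw [integral_indicator_const _ hBm, smul_eq_mul, mul_comm]
    _ ≤ ∫ z, ∑ i, ∑ j ∈ Finset.univ.erase i, (R i).indicator (avgErr (L j)) z ∂D := by
        exact integral_mono ((integrable_const _).indicator hBm)
          (integrable_finsetSum _ fun i _ => hsum i) (Set.indicator_le' (fun z hz =>
          mul_sub_one_le_sum_indicator_avgErr hq hz)
          fun z _ => Finset.sum_nonneg fun i _ => Finset.sum_nonneg fun j _ =>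
            Set.indicator_nonneg (fun z _ => avgErr_nonneg (L j) z) z)
    _ = ∑ i, ∑ j ∈ Finset.univ.erase i, ∫ z in R i, avgErr (L j) z ∂D := by
        rw [integral_finsetSum _ fun i _ => hsum i]
        refine Finset.sum_congr rfl fun i _ => ?_
        rw [integral_finsetSum _ fun j _ => hint i j]
        exact Finset.sum_congr rfl fun j _ => integral_indicator (hRm i)
    _ ≤ ∑ i : Fin n, ∑ _j ∈ Finset.univ.erase i, Q := by
        refine Finset.sum_le_sum fun i _ => Finset.sum_le_sum fun j hj => ?_
        exact setIntegral_avgErr_le D (hL j) hQ0 (hQ i j (Finset.ne_of_mem_erase hj).symm)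
    _ = n * (n - 1) * Q := by
        simp [Finset.card_erase_of_mem, Nat.cast_pred (NeZero.pos n), mul_assoc]

end Aggregation

section ErrControlled

variable {X : Type*} [MeasurableSpace X] {D : Measure (Example X)}

/-- The relative deviation inequality for `g` on the region `R`: up to a factor `3`, the expected
number of errors of `g` in `R` exceeds the number of errors on the sample `S` at most by a multiple
of `D R` with a small factor, at the cost of an additive term that is logarithmic in this factor. -/
def ErrControlled (D : Measure (Example X)) (R : Set (Example X)) (d : ℕ) (θ L : ℝ)
    (S : List (Example X)) (g : Hypothesis X) : Prop :=
  S.length * D.real (R ∩ errSet g) / 3 ≤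
    errCount g S + d * Real.log θ⁻¹ + 2 * S.length * θ * D.real R + L

variable [IsProbabilityMeasure D]

theorem measure_exists_not_errControlled_le {H : Set (Hypothesis X)} {d : ℕ} (hd : vcDim H ≤ d)
    {R : Set (Example X)} (hR : MeasurableSet R) {θ : ℝ} (hθ0 : 0 < θ) (hθ1 : θ ≤ 1) {n : ℕ}
    {G : (Fin n → Example X) → List (Hypothesis X)} (hG : RandomList JointlyMeasurable G)
    (hGH : ∀ s, ∀ g ∈ G s, g ∈ H) (L : ℝ) :
    Measure.pi (fun _ => D) {s | ∃ g ∈ G s, ¬ ErrControlled D R d θ L (List.ofFn s) g} ≤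
      ENNReal.ofReal (Real.exp (-L)) := by
  obtain ⟨fs, hfs, hG⟩ := hG
  have hmem (l : Fin fs.length) (s : Fin n → Example X) : fs.get l s ∈ H :=
    hGH s _ (by rw [hG]; exact List.mem_map_of_mem (fs.get_mem l))
  refine (measure_mono ?_).trans (measure_exists_ncard_lt_le D (vcBound_image_inter_errSet hd R) hR
    (Set.forall_mem_image.2 fun _ _ => Set.inter_subset_left) hθ0 hθ1
    (E := fun (l : Fin fs.length) s => R ∩ errSet (fs.get l s))
    (fun l s => Set.mem_image_of_mem _ (hmem l s)) (fun l => ?_) L)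
  · rintro s ⟨g, hg, hlt⟩
    rw [hG, List.mem_map] at hg
    obtain ⟨f, hf, rfl⟩ := hg
    obtain ⟨l, rfl⟩ := List.get_of_mem hf
    rw [ErrControlled, not_le, errCount_ofFn, List.length_ofFn] at hlt
    refine ⟨l, lt_of_le_of_lt ?_ (by rwa [Fintype.card_fin])⟩
    rw [Fintype.card_fin]
    gcongr
    · exact Set.toFinite _
    · exact Set.inter_subset_right
  · exact (hR.preimage measurable_snd).inter
      ((hfs _ (fs.get_mem l)).measurableSet_mem_errSet measurable_fst measurable_snd)

theorem RandomList.measurableSet_exists_not_errControlled {Ω : Type*} [MeasurableSpace Ω]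
    {B G : Ω → List (Hypothesis X)} (hG : RandomList JointlyMeasurable G)
    (hB : RandomList JointlyMeasurable B) {S : Ω → List (Example X)}
    (hS : RandomList Measurable S) (α : ℝ) (d : ℕ) (θ L : ℝ) :
    MeasurableSet
      {ω | ∃ g ∈ G ω, ¬ ErrControlled D {z | α ≤ avgErr (B ω) z} d θ L (S ω) g} := by
  refine hG.measurableSet_exists_mem (π := id) fun f hf => ?_
  have herr := hf.measurable_errCount hS
  obtain ⟨fs, -, hfs⟩ := hS
  have hlength (ω : Ω) : (S ω).length = fs.length := by rw [hfs, List.length_map]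
  have hregion : MeasurableSet {p : Ω × Example X | α ≤ avgErr (B p.1) p.2} :=
    measurableSet_le measurable_const hB.measurable_avgErr
  have hinter : Measurable fun ω => D.real ({z | α ≤ avgErr (B ω) z} ∩ errSet (f ω)) :=
    (measurable_measure_prodMk_left (hregion.inter
      (hf.measurableSet_mem_errSet measurable_fst measurable_snd))).ennreal_toReal
  have hreal : Measurable fun ω => D.real {z | α ≤ avgErr (B ω) z} :=
    hB.measurable_ensembleError D α
  simp only [ErrControlled, hlength, id]
  exact (measurableSet_le ((hinter.const_mul _).div_const _)
    ((((measurable_from_top.comp herr).add_const _).add (hreal.const_mul _)).add_const _)).compl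

end ErrControlled

section Blocks

variable {X : Type*} [MeasurableSpace X] {A : Learner X}

theorem randomList_ofFn {n : ℕ} {Ω Z : Type*} [MeasurableSpace Ω] [MeasurableSpace Z]
    {f : Ω → Fin n → Z} (hf : Measurable f) : RandomList Measurable fun ω => List.ofFn (f ω) :=
  .ofFn (f := fun a ω => f ω a) fun a => measurable_pi_iff.1 hf a

theorem randomList_const {Ω Z : Type*} [MeasurableSpace Ω] [MeasurableSpace Z] (T : List Z) :
    RandomList Measurable fun _ : Ω => T :=
  .const fun _ _ => measurable_const

theorem randomList_blockHead (k : ℕ) (i : Fin 27) :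
    RandomList Measurable fun z : Fin (3 ^ (k + 6)) → Example X => blockHead k i (List.ofFn z) := by
  simp only [blockHead_ofFn]
  exact randomList_ofFn (by fun_prop)

theorem randomList_blockTail (k : ℕ) (i : Fin 27) :
    RandomList Measurable fun z : Fin (3 ^ (k + 6)) → Example X => blockTail k i (List.ofFn z) := by
  simp only [blockTail_ofFn]
  exact randomList_ofFn (by fun_prop)

theorem IsMeasurableLearner.randomList_blockEnsemble (hA : IsMeasurableLearner A) (k : ℕ)
    (i : Fin 27) (T : List (Example X)) : RandomList JointlyMeasurable
      fun z : Fin (3 ^ (k + 6)) → Example X => blockEnsemble A k i (List.ofFn z) T :=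
  hA.randomList_ensemble (randomList_blockHead k i)
    ((randomList_blockTail k i).append (randomList_const T)) k

variable {D : Measure (Example X)} [IsProbabilityMeasure D]

/-- Conditionally on everything but the tail of block `j`, the region where the ensemble of block
`i` errs is fixed, and the hypotheses of block `j` depend only on the tail. -/
theorem measure_exists_blockEnsemble_not_errControlled_le {H : Set (Hypothesis X)} {d : ℕ}
    (hd : vcDim H ≤ d) (hA : IsMeasurableLearner A) (hAH : ∀ S, A S ∈ H) {θ : ℝ} (hθ0 : 0 < θ)
    (hθ1 : θ ≤ 1) (α : ℝ) (k : ℕ) {i j : Fin 27} (hij : i ≠ j) (T : List (Example X)) (L : ℝ) :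
    Measure.pi (fun _ => D) {z : Fin (3 ^ (k + 6)) → Example X |
      ∃ g ∈ blockEnsemble A k j (List.ofFn z) T,
        ¬ ErrControlled D {x | α ≤ avgErr (blockEnsemble A k i (List.ofFn z) T) x} d θ L
          (blockTail k j (List.ofFn z)) g} ≤ ENNReal.ofReal (Real.exp (-L)) := by
  have hrandom := hA.randomList_blockEnsemble k (T := T)
  refine measure_pi_le_of_forall_extend D (tailIndex_injective k j)
    ((hrandom j).measurableSet_exists_not_errControlled (hrandom i) (randomList_blockTail k j)
      α d θ L) fun z => ?_
  simp only [Set.mem_ofPred_eq, blockEnsemble, blockTail_ofFn_extend_tailIndex,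
    blockHead_ofFn_extend_tailIndex, blockTail_ofFn_extend_tailIndex_of_ne k z hij.symm]
  refine measure_exists_not_errControlled_le hd (measurableSet_le measurable_const
    (measurable_avgErr ?_)) hθ0 hθ1 (hA.randomList_ensemble (randomList_const _)
      ((randomList_ofFn measurable_id).append (randomList_const T)) k) ?_ L
  · exact List.forall_mem_map.2 fun S' _ => hA.measurable_apply S'
  · exact fun s => List.forall_mem_map.2 fun S' _ => hAH S'

end Blocks

section BlockErrors

variable {X : Type*} {A : Learner X} {h : Hypothesis X}

theorem errCount_blockTail_le_of_mem_blockEnsemble (hAh : ∀ S, errCount (A S) S ≤ errCount h S)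
    {k : ℕ} {i : Fin 27} {S T : List (Example X)} {U : ℝ}
    (hU : ∀ S' ∈ split (k + 6) S T, errCount h S' ≤ U) {g : Hypothesis X}
    (hg : g ∈ blockEnsemble A k i S T) : errCount g (blockTail k i S) ≤ U := by
  obtain ⟨S', hS', rfl⟩ := List.mem_map.1 hg
  have htail : (blockTail k i S).Sublist S' :=
    (List.sublist_append_left _ T).trans (suffix_of_mem_split hS').sublist
  refine le_trans ?_ (hU S' (mem_split_add_six.2 ⟨i, hS'⟩))
  exact_mod_cast (errCount_le_of_sublist _ htail).trans (hAh S')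

end BlockErrors

section Recursion

variable {X : Type*} [MeasurableSpace X]

/-- The bound of the theorem for one realisation `S` of the sample, multiplied by its size `3 ^ k`,
and without the factor `sCap`; the comparison hypothesis is `h` and the maximum over the splitting
scheme is expressed by an existential quantifier. -/
def HasErrorBound (D : Measure (Example X)) (A : Learner X) (h : Hypothesis X) (c b : ℝ) (k : ℕ)
    (S T : List (Example X)) : Prop :=
  ∃ S' ∈ split k S T, 3 ^ k * ensembleError D (10 / 243) (ensemble A k S T) ≤
    c * (errCount h S' + b)

variable {D : Measure (Example X)} {A : Learner X} {h : Hypothesis X}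

theorem HasErrorBound.ensembleError_le {c b : ℝ} (hc : 0 ≤ c) {k : ℕ} {S T : List (Example X)}
    (hS : HasErrorBound D A h c b k S T) : ensembleError D (10 / 243) (ensemble A k S T) ≤
      (⨆ S' : {S' // S' ∈ split k S T}, c * (errCount h S'.1 : ℝ) / ((3 : ℝ) ^ k / sCap)) +
        c * b / 3 ^ k := by
  obtain ⟨S', hS', hbound⟩ := hS
  have hfinite : Finite {S' // S' ∈ split k S T} := (split k S T).finite_toSet.to_subtype
  have hpos : (0 : ℝ) < 3 ^ k := by positivity
  have hsCap : 1 ≤ sCap := by norm_num [sCap]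
  calc ensembleError D (10 / 243) (ensemble A k S T)
      ≤ c * errCount h S' / 3 ^ k + c * b / 3 ^ k := by
        rw [← add_div, ← mul_add, le_div_iff₀' hpos]
        exact hbound
    _ ≤ c * errCount h S' / (3 ^ k / sCap) + c * b / 3 ^ k := by
        gcongr
        exact div_le_self hpos.le hsCap
    _ ≤ _ := by
        gcongr
        exact le_ciSup (f := fun S' : {S' // S' ∈ split k S T} =>
          c * (errCount h S'.1 : ℝ) / ((3 : ℝ) ^ k / sCap)) (Set.finite_range _).bddAbove ⟨S', hS'⟩

theorem log_pow_three_le (n : ℕ) : Real.log (3 ^ n) ≤ 2 * n := by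
  have hlog := Real.log_le_sub_one_of_pos (show (0 : ℝ) < 3 by norm_num)
  rw [Real.log_pow]
  nlinarith [n.cast_nonneg (α := ℝ)]

theorem ErrControlled.measureReal_inter_le {R : Set (Example X)} {d : ℕ} (hd : 1 ≤ d) {L : ℝ}
    (hL : 0 ≤ L) {S : List (Example X)} {g : Hypothesis X}
    (hg : ErrControlled D R d (3 ^ 19)⁻¹ (L + Real.log (3 ^ 6)) S g) {k : ℕ}
    (hS : S.length = 26 * 3 ^ k) {U : ℝ} (hU : errCount g S ≤ U - (d + L))
    (hR : 3 ^ k * D.real R ≤ 3 ^ 16 * (13 * U)) :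
    D.real (R ∩ errSet g) ≤ 3 / 26 * (50 + 52 * 13 / 27) * U / 3 ^ k := by
  have hd' : (1 : ℝ) ≤ d := Nat.one_le_cast.2 hd
  have hcount : (0 : ℝ) ≤ errCount g S := Nat.cast_nonneg _
  have hlog6 : Real.log (3 ^ 6) ≤ 12 := (log_pow_three_le 6).trans (by norm_num)
  have hlog19 : d * Real.log (3 ^ 19) ≤ d * 38 := by
    gcongr
    exact (log_pow_three_le 19).trans (by norm_num)
  have hregion : 2 * (26 * 3 ^ k) * (3 ^ 19)⁻¹ * D.real R ≤ 52 * 13 / 27 * U := by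
    linarith
  have hcontrol : 26 * 3 ^ k * D.real (R ∩ errSet g) / 3 ≤ errCount g S +
      d * Real.log (3 ^ 19) + 2 * (26 * 3 ^ k) * (3 ^ 19)⁻¹ * D.real R +
        (L + Real.log (3 ^ 6)) := by
    rw [ErrControlled, hS, inv_inv] at hg
    exact_mod_cast hg
  have hinter : 26 * 3 ^ k * D.real (R ∩ errSet g) / 3 ≤ (50 + 52 * 13 / 27) * U :=
    calc _ ≤ U - (d + L) + d * 38 + 52 * 13 / 27 * U + (L + 12) := by
          refine hcontrol.trans ?_
          gcongr
      _ ≤ (50 + 52 * 13 / 27) * U := by linarith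
  rw [le_div_iff₀ (by positivity)]
  linarith

variable [IsProbabilityMeasure D]

theorem hasErrorBound_of_lt (h : Hypothesis X) {k : ℕ} (hk : k < 6) {b : ℝ} (hb : 1 ≤ b)
    (S T : List (Example X)) : HasErrorBound D A h (3 ^ 16) b k S T := by
  refine ⟨S ++ T, by rw [split_of_lt hk, List.mem_singleton], ?_⟩
  calc (3 : ℝ) ^ k * ensembleError D (10 / 243) (ensemble A k S T) ≤ 3 ^ 16 * 1 :=
        mul_le_mul (pow_le_pow_right₀ (by norm_num) (by lia)) (ensembleError_le_one D _ _)
          (ensembleError_nonneg D _ _) (by positivity)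
    _ ≤ 3 ^ 16 * (errCount h (S ++ T) + b) := by
        gcongr
        linarith [(errCount h (S ++ T)).cast_nonneg (α := ℝ)]

/-- The constants close the recursion because `3 ^ 16 / (9 * 3 ^ 6) = 6561`, whereas
`27 * 26 * (3 / 26) * (50 + 52 * 13 / 27)` is about `6078`. -/
theorem HasErrorBound.add_six {d : ℕ} (hd : 1 ≤ d) (hAm : ∀ S, Measurable (A S))
    (hAh : ∀ S, errCount (A S) S ≤ errCount h S) {L : ℝ} (hL : 0 ≤ L) {k : ℕ}
    {S T : List (Example X)} (hS : ∀ i : Fin 27, (blockTail k i S).length = 26 * 3 ^ k)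
    (hblock : ∀ i : Fin 27, HasErrorBound D A h (3 ^ 16) (d + (L + Real.log (3 ^ 6))) k
      (blockHead k i S) (blockTail k i S ++ T))
    (hpair : ∀ i j : Fin 27, i ≠ j → ∀ g ∈ blockEnsemble A k j S T,
      ErrControlled D {z | 10 / 243 ≤ avgErr (blockEnsemble A k i S T) z} d (3 ^ 19)⁻¹
        (L + Real.log (3 ^ 6)) (blockTail k j S) g) :
    HasErrorBound D A h (3 ^ 16) (d + L) (k + 6) S T := by
  by_contra hfail
  simp only [HasErrorBound, not_exists, not_and, not_le] at hfail
  set U : ℝ := 3 ^ (k + 6) * ensembleError D (10 / 243) (ensemble A (k + 6) S T) / 3 ^ 16 with hU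
  have hN : (0 : ℝ) < 3 ^ k := by positivity
  have herr (S') (hS' : S' ∈ split (k + 6) S T) : errCount h S' ≤ U - (d + L) := by
    have := (lt_div_iff₀' (by positivity)).2 (hfail S' hS')
    linarith
  have hU1 : 1 ≤ U - L := by
    obtain ⟨S', hS'⟩ := List.exists_mem_of_ne_nil _ (split_ne_nil (k + 6) S T)
    linarith [herr S' hS', (errCount h S').cast_nonneg (α := ℝ), Nat.one_le_cast (α := ℝ).2 hd]
  have hregion (i : Fin 27) : 3 ^ k * D.real {z | 10 / 243 ≤ avgErr (blockEnsemble A k i S T) z} ≤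
      3 ^ 16 * (13 * U) := by
    obtain ⟨S', hS', hbound⟩ := hblock i
    refine hbound.trans ?_
    gcongr
    have hlog : Real.log (3 ^ 6) ≤ 12 := (log_pow_three_le 6).trans (by norm_num)
    linarith [herr S' (mem_split_add_six.2 ⟨i, hS'⟩)]
  have hagg := ensembleError_flatMap_le D (L := fun i => blockEnsemble A k i S T)
    (Q := 3 / 26 * (50 + 52 * 13 / 27) * U / 3 ^ k)
    (fun i _ => length_blockEnsemble A k i S T) (fun i => List.forall_mem_map.2 fun S' _ => hAm S')
    (div_nonneg (mul_nonneg (by norm_num) (by linarith)) hN.le)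
    fun i j hij g hg => (hpair i j hij g hg).measureReal_inter_le hd hL (hS j)
      (errCount_blockTail_le_of_mem_blockEnsemble hAh herr hg) (hregion i)
  push_cast at hagg
  rw [← ensemble_add_six, ← mul_div_assoc (27 * (27 - 1) : ℝ), le_div_iff₀ hN] at hagg
  rw [eq_div_iff (by positivity), pow_add] at hU
  linarith

end Recursion

section HighProbability

variable {X : Type*} [MeasurableSpace X] {A : Learner X} {h : Hypothesis X}
  {D : Measure (Example X)} [IsProbabilityMeasure D]

theorem RandomList.measurableSet_hasErrorBound (hA : IsMeasurableLearner A) (hh : Measurable h)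
    {Ω : Type*} [MeasurableSpace Ω] {S T : Ω → List (Example X)} (hS : RandomList Measurable S)
    (hT : RandomList Measurable T) (c b : ℝ) (k : ℕ) :
    MeasurableSet {ω | HasErrorBound D A h c b k (S ω) (T ω)} := by
  refine (hS.split hT k).measurableSet_exists_mem (π := id) fun S' hS' => ?_
  have hcount : Measurable fun ω => (errCount h (S' ω) : ℝ) :=
    measurable_from_top.comp ((JointlyMeasurable.const hh).measurable_errCount hS')
  have herror := (hA.randomList_ensemble hS hT k).measurable_ensembleError D (10 / 243)
  exact measurableSet_le (herror.const_mul _) ((hcount.add_const b).const_mul c)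

theorem measure_not_hasErrorBound_block_le (hA : IsMeasurableLearner A) (hh : Measurable h)
    {c b : ℝ} {k : ℕ} {ε : ENNReal} (hε : ∀ T, Measure.pi (fun _ => D)
      {s : Fin (3 ^ k) → Example X | ¬ HasErrorBound D A h c b k (List.ofFn s) T} ≤ ε)
    (i : Fin 27) (T : List (Example X)) :
    Measure.pi (fun _ => D) {z : Fin (3 ^ (k + 6)) → Example X | ¬ HasErrorBound D A h c b k
      (blockHead k i (List.ofFn z)) (blockTail k i (List.ofFn z) ++ T)} ≤ ε := by
  refine measure_pi_le_of_forall_extend D (headIndex_injective k i)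
    (RandomList.measurableSet_hasErrorBound hA hh (randomList_blockHead k i)
      ((randomList_blockTail k i).append (randomList_const T)) c b k).compl fun z => ?_
  simp only [Set.mem_compl_iff, Set.mem_ofPred_eq, blockHead_ofFn_extend_headIndex,
    blockTail_ofFn_extend_headIndex]
  exact hε _

theorem measure_le_of_subset_iUnion {Ω κ : Type*} [MeasurableSpace Ω] [Fintype κ] [Nonempty κ]
    {μ : Measure Ω} {s : Set Ω} {bad : κ → Set Ω} (hs : s ⊆ ⋃ p, bad p) {L : ℝ}
    (hbad : ∀ p, μ (bad p) ≤ ENNReal.ofReal (Real.exp (-(L + Real.log (Fintype.card κ))))) :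
    μ s ≤ ENNReal.ofReal (Real.exp (-L)) := by
  have hcard : (0 : ℝ) < Fintype.card κ := Nat.cast_pos.2 Fintype.card_pos
  calc μ s ≤ ∑ p, μ (bad p) := (measure_mono hs).trans (measure_iUnion_fintype_le _ _)
    _ ≤ ∑ _p : κ, ENNReal.ofReal (Real.exp (-(L + Real.log (Fintype.card κ)))) :=
      Finset.sum_le_sum fun p _ => hbad p
    _ = ENNReal.ofReal (Real.exp (-L)) := by
      rw [Finset.sum_const, nsmul_eq_mul, Finset.card_univ, ← ENNReal.ofReal_natCast,
        ← ENNReal.ofReal_mul hcard.le, neg_add, Real.exp_add, Real.exp_neg (Real.log _),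
        Real.exp_log hcard, mul_left_comm, mul_inv_cancel₀ hcard.ne', mul_one]

variable {H : Set (Hypothesis X)}

theorem measure_not_hasErrorBound_le {d : ℕ} (hd : vcDim H ≤ d) (hd1 : 1 ≤ d)
    (hA : IsMeasurableLearner A) (hAH : ∀ S, A S ∈ H) (hh : Measurable h)
    (hAh : ∀ S, errCount (A S) S ≤ errCount h S) (k : ℕ) {L : ℝ} (hL : 0 ≤ L)
    (T : List (Example X)) :
    Measure.pi (fun _ => D) {s : Fin (3 ^ k) → Example X |
      ¬ HasErrorBound D A h (3 ^ 16) (d + L) k (List.ofFn s) T} ≤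
        ENNReal.ofReal (Real.exp (-L)) := by
  induction k using split_induction generalizing L T with
  | base k hk =>
    have hb : 1 ≤ d + L := le_add_of_le_of_nonneg (Nat.one_le_cast.2 hd1) hL
    simp [hasErrorBound_of_lt h hk hb]
  | step k ih =>
    let bad (p : Fin 27 × Fin 27) : Set (Fin (3 ^ (k + 6)) → Example X) :=
      if p.1 = p.2 then {z | ¬ HasErrorBound D A h (3 ^ 16) (d + (L + Real.log (3 ^ 6))) k
        (blockHead k p.1 (List.ofFn z)) (blockTail k p.1 (List.ofFn z) ++ T)}
      else {z | ∃ g ∈ blockEnsemble A k p.2 (List.ofFn z) T,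
        ¬ ErrControlled D {x | 10 / 243 ≤ avgErr (blockEnsemble A k p.1 (List.ofFn z) T) x} d
          (3 ^ 19)⁻¹ (L + Real.log (3 ^ 6)) (blockTail k p.2 (List.ofFn z)) g}
    have hbad (p) : Measure.pi (fun _ => D) (bad p) ≤
        ENNReal.ofReal (Real.exp (-(L + Real.log (3 ^ 6)))) := by
      obtain ⟨i, j⟩ := p
      rcases eq_or_ne i j with rfl | hij
      · simp only [bad, if_true]
        exact measure_not_hasErrorBound_block_le hA hh
          (fun T => ih (add_nonneg hL (Real.log_nonneg (by norm_num))) T) i T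
      · simp only [bad, if_neg hij]
        exact measure_exists_blockEnsemble_not_errControlled_le hd hA hAH (by positivity)
          (inv_le_one_of_one_le₀ (by norm_num)) _ k hij T _
    have hlog : Real.log (3 ^ 6) = Real.log (Fintype.card (Fin 27 × Fin 27)) := by norm_num
    refine measure_le_of_subset_iUnion (bad := bad) (fun z hz => ?_) fun p => hlog ▸ hbad p
    by_contra hgood
    simp only [Set.mem_iUnion, not_exists] at hgood
    refine hz (.add_six hd1 hA.measurable_apply hAh hL (fun i => ?_) (fun i => ?_)
      fun i j hij => ?_)
    · rw [blockTail_ofFn, List.length_ofFn]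
    · simpa [bad] using hgood (i, i)
    · simpa [bad, hij] using hgood (i, j)

theorem ensembleError_le_measureReal_errSet (D : Measure (Example X)) [IsProbabilityMeasure D]
    {α : ℝ} (hα : 0 < α) {L : List (Hypothesis X)} {g : Hypothesis X} (hL : ∀ f ∈ L, f = g) :
    ensembleError D α L ≤ D.real (errSet g) := by
  refine measureReal_mono fun z hz => ?_
  by_contra hzg
  refine hα.not_ge (le_trans hz (le_of_eq ?_))
  rw [avgErr, List.countP_eq_zero.2 fun f hf => by simpa [hL f hf, errSet] using hzg]
  norm_num

theorem ErrControlled.hasErrorBound {g : Hypothesis X} (hA : ∀ S, A S = g)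
    (hAh : ∀ S, errCount (A S) S ≤ errCount h S) {L : ℝ} (hL : 0 ≤ L) {U : List (Example X)}
    (hU : ErrControlled D (errSet g) 0 12⁻¹ L U g) {k : ℕ} (hk : 3 ^ k ≤ 29 * U.length)
    {S T S' : List (Example X)} (hS' : S' ∈ split k S T) (hsub : U.Sublist S') :
    HasErrorBound D A h (3 ^ 16) L k S T := by
  refine ⟨S', hS', ?_⟩
  have herr : (errCount g U : ℝ) ≤ errCount h S' :=
    mod_cast (errCount_le_of_sublist g hsub).trans (hA S' ▸ hAh S')
  have hcount : (0 : ℝ) ≤ errCount h S' := Nat.cast_nonneg _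
  rw [ErrControlled, Set.inter_self, Nat.cast_zero, zero_mul] at hU
  calc 3 ^ k * ensembleError D (10 / 243) (ensemble A k S T)
      ≤ 3 ^ k * D.real (errSet g) := by
        gcongr
        exact ensembleError_le_measureReal_errSet D (by norm_num)
          (List.forall_mem_map.2 fun S' _ => hA S')
    _ ≤ 29 * U.length * D.real (errSet g) := by
        gcongr
        exact_mod_cast hk
    _ ≤ 3 ^ 16 * (errCount h S' + L) := by linarith

/-- A class of dimension `0` has at most one element, so one application of the relative deviation
inequality replaces the recursion, whose base case requires `1 ≤ d`. -/
theorem measure_not_hasErrorBound_le_of_vcDim_le_zero (hd : vcDim H ≤ (0 : ℕ))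
    (hA : IsMeasurableLearner A) (hAH : ∀ S, A S ∈ H) (hAh : ∀ S, errCount (A S) S ≤ errCount h S)
    (k : ℕ) {L : ℝ} (hL : 0 ≤ L) (T : List (Example X)) :
    Measure.pi (fun _ => D) {s : Fin (3 ^ k) → Example X |
      ¬ HasErrorBound D A h (3 ^ 16) L k (List.ofFn s) T} ≤ ENNReal.ofReal (Real.exp (-L)) := by
  obtain ⟨g, hgH, hg, hAg⟩ : ∃ g ∈ H, Measurable g ∧ ∀ S, A S = g :=
    ⟨A [], hAH [], hA.measurable_apply [], fun S => eq_of_vcDim_le_zero hd (hAH S) (hAH [])⟩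
  obtain ⟨n, e, he, hn, hsub⟩ := exists_subsample_sublist_mem_split (Z := Example X) k
  let bad : Set (Fin n → Example X) :=
    {s | ¬ ErrControlled D (errSet g) 0 12⁻¹ L (List.ofFn s) g}
  have hbad : MeasurableSet bad := by
    have hcount : Measurable fun s : Fin n → Example X => (errCount g (List.ofFn s) : ℝ) :=
      measurable_from_top.comp
        ((JointlyMeasurable.const hg).measurable_errCount (randomList_ofFn measurable_id))
    simp only [bad, ErrControlled, List.length_ofFn]
    exact (measurableSet_le measurable_const
      (((hcount.add_const _).add_const _).add_const _)).compl
  calc _ ≤ Measure.pi (fun _ => D) {z : Fin (3 ^ k) → Example X | z ∘ e ∈ bad} := by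
        refine measure_mono fun z hz hgood => hz ?_
        obtain ⟨S', hS', hsublist⟩ := hsub z T
        exact hgood.hasErrorBound hAg hAh hL (by rwa [List.length_ofFn]) hS' hsublist
    _ ≤ ENNReal.ofReal (Real.exp (-L)) := by
        refine measure_pi_le_of_forall_extend D he (hbad.preimage (by fun_prop)) fun z => ?_
        have hmain := measure_exists_not_errControlled_le hd (measurableSet_errSet hg) (D := D)
          (θ := 12⁻¹) (by norm_num) (by norm_num) (G := fun _ : Fin n → Example X => [g])
          (.const (by simpa using JointlyMeasurable.const hg)) (by simpa using fun _ => hgH) L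
        simpa [bad, Function.extend_comp he] using hmain

end HighProbability

end AgnosticVC

end

open AgnosticVC in
theorem mainTheorem4_general {X : Type*} [MeasurableSpace X] {H : Set (Hypothesis X)} {d : ℕ}
    (hd : vcDim H ≤ d) {A : Learner X} (hA : IsMeasurableLearner A) (hAH : ∀ S, A S ∈ H)
    {h : Hypothesis X} (hh : Measurable h) (hAh : ∀ S, errCount (A S) S ≤ errCount h S)
    (D : Measure (Example X)) [IsProbabilityMeasure D] {δ : ℝ} (hδ0 : 0 < δ) (hδ1 : δ ≤ 1) (k : ℕ)
    (T : List (Example X)) :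
    1 - δ ≤ (Measure.pi fun _ : Fin (3 ^ k) => D).real {S : Fin (3 ^ k) → Example X |
      ensembleError D (10 / 243) (ensemble A k (List.ofFn S) T) ≤
        (⨆ S' : {S' // S' ∈ split k (List.ofFn S) T},
          3 ^ 16 * (errCount h S'.1 : ℝ) / (((3 ^ k : ℕ) : ℝ) / sCap)) +
        3 ^ 16 * (d + Real.log (1 / δ)) / ((3 ^ k : ℕ) : ℝ)} := by
  have hL : 0 ≤ Real.log (1 / δ) := Real.log_nonneg ((one_le_div₀ hδ0).2 hδ1)
  have hexp : Real.exp (-Real.log (1 / δ)) = δ := by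
    rw [one_div, Real.log_inv, neg_neg, Real.exp_log hδ0]
  let good : Set (Fin (3 ^ k) → Example X) :=
    {S | HasErrorBound D A h (3 ^ 16) (d + Real.log (1 / δ)) k (List.ofFn S) T}
  have hgood : Measure.pi (fun _ => D) goodᶜ ≤ ENNReal.ofReal δ := by
    rw [← hexp]
    rcases Nat.eq_zero_or_pos d with rfl | hd1
    · simpa [good, Set.compl_ofPred] using
        measure_not_hasErrorBound_le_of_vcDim_le_zero hd hA hAH hAh k hL T
    · exact measure_not_hasErrorBound_le hd hd1 hA hAH hh hAh k hL T
  calc 1 - δ ≤ 1 - (Measure.pi fun _ => D).real goodᶜ :=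
        sub_le_sub_left (ENNReal.toReal_le_of_le_ofReal hδ0.le hgood) 1
    _ = (Measure.pi fun _ => D).real good := by
      have hmeas : MeasurableSet good := RandomList.measurableSet_hasErrorBound hA hh
        (randomList_ofFn measurable_id) (randomList_const T) _ _ k
      rw [probReal_compl_eq_one_sub hmeas, sub_sub_cancel]
    _ ≤ _ := measureReal_mono fun S hS => by
      simpa only [Set.mem_ofPred_eq, Nat.cast_pow, Nat.cast_ofNat] using
        HasErrorBound.ensembleError_le (by norm_num) hS

theorem mainTheorem4 :
    ∃ c : ℝ, 1 ≤ c ∧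
      ∀ (X : Type*) [MeasurableSpace X]
        (H : Set (AgnosticVC.Hypothesis X)) (d : ℕ)
        (A : AgnosticVC.Learner X)
        (D : Measure (AgnosticVC.Example X)) [IsProbabilityMeasure D]
        (hStar : AgnosticVC.Hypothesis X)
        (δ : ℝ) (k m : ℕ) (T : List (AgnosticVC.Example X)),
        (∀ h ∈ H, Measurable h) →
        AgnosticVC.vcDim H = (d : ℕ∞) →
        AgnosticVC.IsERM H A →
        AgnosticVC.IsMeasurableLearner A →
        AgnosticVC.IsBest D H hStar →
        0 < δ → δ < 1 →
        m = 3 ^ k →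
        1 - δ ≤ (Measure.pi fun _ : Fin m => D).real
          {S : Fin m → AgnosticVC.Example X |
            AgnosticVC.ensembleError D (10 / 243) (AgnosticVC.ensemble A k (List.ofFn S) T) ≤
              (⨆ S' : {S' // S' ∈ AgnosticVC.split k (List.ofFn S) T},
                c * (AgnosticVC.errCount hStar S'.1 : ℝ) / ((m : ℝ) / AgnosticVC.sCap)) +
              c * ((d : ℝ) + Real.log (1 / δ)) / (m : ℝ)} := by
  refine ⟨3 ^ 16, by norm_num, ?_⟩
  rintro X _ H d A D _ hStar δ k m T hH hd hERM hA hbest hδ0 hδ1 rfl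
  exact mainTheorem4_general hd.le hA (fun S => (hERM S).1) (hH hStar hbest.1)
    (hERM.errCount_le hbest.1) D hδ0 hδ1.le k T
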